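/- Let $\mathbb{F}$ be a finite field with $k$ elements, and let $\mathbb{F}((X^{-1}))$ be the field of formal Laurent series $f=\sum_{i\ge i_0} a_i X^{-i}$ with $i_0\in\mathbb{Z}$ and $a_i\in\mathbb{F}$, with the absolute value $|0|=0$ and $|f|=k^{d}$ if $X^{d}$ is the largest power of $X$ that occurs in $f\neq 0$ with non-zero coefficient. On $\mathbb{F}((X^{-1}))^d$ and on spaces of matrices over $\mathbb{F}((X^{-1}))$ use the maximum norm $|\cdot|_\infty$ of the entries and the metric that it induces. For $\mathbf{v}\in\mathbb{F}((X^{-1}))^n$ let $\|\mathbf{v}\|$ be the distance from $\mathbf{v}$ to the nearest element of $\mathbb{F}[X]^n$. Let $m,n\ge 1$ be integers, and let $\psi:\mathbb{F}[X]^m\to\{k^r : r\in\mathbb{Z}\}\cup\{0\}$ be bounded (it is non-negative) with $\psi(\mathbf{q})>0$ for infinitely many $\mathbf{q}$. Define $$\mathcal{W}(m,n;\psi)=\{A\in \mathrm{Mat}_{m\times n}(\mathbb{F}((X^{-1}))) : \|\mathbf{q}A\|<\psi(\mathbf{q}) \text{ for infinitely many } \mathbf{q}\in\mathbb{F}[X]^m\}$$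 and $$\eta(\psi)=\inf\Big\{\eta\in\mathbb{R} : \sum_{\mathbf{q}\in\mathbb{F}[X]^m,\ \mathbf{q}\neq 0}|\mathbf{q}|_\infty^n\Big(\frac{\psi(\mathbf{q})}{|\mathbf{q}|_\infty}\Big)^{\eta}<\infty\Big\}.$$ Then the Hausdorff dimension of $\mathcal{W}(m,n;\psi)$ is $$\dim_{\mathrm{H}}\mathcal{W}(m,n;\psi)=n(m-1)+\min\{\eta(\psi),n\}.$$ -/

import Mathlib

open Polynomial
open scoped ENNReal

/-- The field `F((X⁻¹))` of formal Laurent series `∑_{i ≥ i₀} aᵢ X⁻ⁱ` over `F`.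
The underlying field is `LaurentSeries F`, whose variable plays the role of `X⁻¹`.  It is a type
of its own so that it can carry the absolute value below. -/
def LaurentAtInfty (F : Type*) [Field F] : Type _ := LaurentSeries F

namespace LaurentAtInfty

variable {F : Type*} [Field F]

noncomputable instance instField : Field (LaurentAtInfty F) :=
  inferInstanceAs (Field (LaurentSeries F))

/-- The Laurent series underlying an element of `F((X⁻¹))`; the coefficient of index `i` is
that of `X⁻ⁱ`. -/
def toSeries (f : LaurentAtInfty F) : LaurentSeries F := f

/-- The absolute value on `F((X⁻¹))`: `|0| = 0`, and `|f| = kⁿ` if `Xⁿ` is the largest power of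
`X` that occurs in `f ≠ 0`, where `k` is the number of elements of `F`.  (The order of `f` as a
series in `X⁻¹` is then `-n`.) -/
noncomputable def absVal (f : LaurentAtInfty F) : ℝ :=
  open Classical in
  if f = 0 then 0 else (Nat.card F : ℝ) ^ (-(HahnSeries.order f.toSeries))

theorem absVal_zero : absVal (0 : LaurentAtInfty F) = 0 := by
  simp [absVal]

theorem absVal_of_ne {f : LaurentAtInfty F} (hf : f ≠ 0) :
    absVal f = (Nat.card F : ℝ) ^ (-(HahnSeries.order f.toSeries)) := by
  simp [absVal, hf]

theorem one_lt_natCard [Finite F] : (1 : ℝ) < (Nat.card F : ℝ) := by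
  exact_mod_cast Finite.one_lt_card

theorem absVal_pos [Finite F] {f : LaurentAtInfty F} (hf : f ≠ 0) : 0 < absVal f := by
  rw [absVal_of_ne hf]
  exact zpow_pos (zero_lt_one.trans one_lt_natCard) _

theorem absVal_nonneg [Finite F] (f : LaurentAtInfty F) : 0 ≤ absVal f := by
  by_cases hf : f = 0
  · rw [hf, absVal_zero]
  · exact (absVal_pos hf).le

theorem absVal_mul [Finite F] (f g : LaurentAtInfty F) :
    absVal (f * g) = absVal f * absVal g := by
  by_cases hf : f = 0
  · simp [hf, absVal_zero]
  by_cases hg : g = 0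
  · simp [hg, absVal_zero]
  rw [absVal_of_ne hf, absVal_of_ne hg, absVal_of_ne (mul_ne_zero hf hg),
    ← zpow_add₀ (zero_lt_one.trans one_lt_natCard).ne']
  have h : HahnSeries.order (f * g).toSeries
      = HahnSeries.order f.toSeries + HahnSeries.order g.toSeries :=
    HahnSeries.order_mul (x := f.toSeries) (y := g.toSeries) hf hg
  rw [h]
  congr 1
  ring

theorem absVal_neg (f : LaurentAtInfty F) : absVal (-f) = absVal f := by
  by_cases hf : f = 0
  · simp [hf]
  rw [absVal_of_ne hf, absVal_of_ne (neg_ne_zero.mpr hf)]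
  have h : HahnSeries.order (-f).toSeries = HahnSeries.order f.toSeries :=
    HahnSeries.order_neg (f := f.toSeries)
  rw [h]

/-- The strong triangle inequality. -/
theorem absVal_add_le_max [Finite F] (f g : LaurentAtInfty F) :
    absVal (f + g) ≤ max (absVal f) (absVal g) := by
  by_cases hf : f = 0
  · simp [hf]
  by_cases hg : g = 0
  · simp [hg]
  by_cases hfg : f + g = 0
  · rw [hfg, absVal_zero]
    exact le_max_of_le_left (absVal_nonneg f)
  have h : min (HahnSeries.order f.toSeries) (HahnSeries.order g.toSeries)
      ≤ HahnSeries.order (f + g).toSeries :=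
    HahnSeries.min_order_le_order_add (x := f.toSeries) (y := g.toSeries) hfg
  rw [absVal_of_ne hf, absVal_of_ne hg, absVal_of_ne hfg]
  rcases min_le_iff.mp h with h | h
  · exact le_max_of_le_left (zpow_le_zpow_right₀ one_lt_natCard.le (neg_le_neg h))
  · exact le_max_of_le_right (zpow_le_zpow_right₀ one_lt_natCard.le (neg_le_neg h))

theorem absVal_add_le [Finite F] (f g : LaurentAtInfty F) :
    absVal (f + g) ≤ absVal f + absVal g :=
  (absVal_add_le_max f g).trans
    (max_le_add_of_nonneg (absVal_nonneg f) (absVal_nonneg g))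

/-- `F((X⁻¹))` with its absolute value and the metric `|f - g|`. -/
noncomputable instance instNormedField [Finite F] : NormedField (LaurentAtInfty F) :=
  { instField with
    norm := absVal
    dist := fun f g => absVal (-f + g)
    dist_self := fun f => by simp [absVal_zero]
    dist_comm := fun f g => by
      rw [← absVal_neg (-f + g)]
      congr 1
      ring
    dist_triangle := fun f g h => by
      have := absVal_add_le (-f + g) (-g + h)
      rwa [show -f + g + (-g + h) = -f + h by ring] at this
    eq_of_dist_eq_zero := fun {f g} h => by
      by_contra hne
      have h0 : -f + g ≠ 0 := fun h0 => hne (neg_add_eq_zero.mp h0)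
      exact (absVal_pos h0).ne' h
    dist_eq := fun f g => rfl
    norm_mul := absVal_mul }

/-- The inclusion `F[X] ⊆ F((X⁻¹))`: constants go to constants, and `X` goes to the series with
the single coefficient `1` at index `-1`, that is, to the inverse of the variable `X⁻¹`. -/
noncomputable def ofPoly : F[X] →+* LaurentAtInfty F :=
  Polynomial.eval₂RingHom (HahnSeries.C : F →+* LaurentSeries F)
    (HahnSeries.single (-1 : ℤ) (1 : F))

/-- The inclusion `F[X]^d ⊆ F((X⁻¹))^d`, coordinate by coordinate. -/
noncomputable def ofPolyVec {d : ℕ} (q : Fin d → F[X]) : Fin d → LaurentAtInfty F :=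
  fun i => ofPoly (q i)

/-- `‖v‖`: the distance from `v` to `F[X]^d` in the metric of the norm
`|x|_∞ = max (|x₁|, …, |x_d|)`, which is the norm that Mathlib puts on `Fin d → _`. -/
noncomputable def distToPoly [Finite F] {d : ℕ} (v : Fin d → LaurentAtInfty F) : ℝ :=
  Metric.infDist v (Set.range (ofPolyVec (F := F) (d := d)))

/-- `W(m, n; ψ)`: the `m × n` matrices `A` over `F((X⁻¹))` such that `‖q A‖ < ψ(q)` for infinitely
many `q ∈ F[X]^m`. -/
def approxSet [Finite F] (m n : ℕ) (ψ : (Fin m → F[X]) → ℝ) :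
    Set (Matrix (Fin m) (Fin n) (LaurentAtInfty F)) :=
  {A | {q : Fin m → F[X] | distToPoly (Matrix.vecMul (ofPolyVec q) A) < ψ q}.Infinite}

/-- `η(ψ)`: the infimum, in the extended reals, of all real `η` such that
`∑_q |q|_∞^n (ψ(q) / |q|_∞)^η < ∞`.  (For `n ≥ 1` the term of `q = 0` is `0`, so that the sum is
over `q ≠ 0`.) -/
noncomputable def convExponent [Finite F] (m n : ℕ) (ψ : (Fin m → F[X]) → ℝ) : EReal :=
  ⨅ (η : ℝ) (_ : Summable fun q : Fin m → F[X] =>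
    ‖ofPolyVec q‖ ^ n * (ψ q / ‖ofPolyVec q‖) ^ η), (η : EReal)

end LaurentAtInfty

/- Matrices carry the maximum norm of their entries, as vectors with `m * n` coordinates. -/
attribute [local instance] Matrix.normedAddCommGroup

/-!
A matrix with entries of absolute value less than `1` is the same as a sequence of digits, the
`j`-th digit being the matrix of the coefficients of `X⁻ʲ⁻¹`.  Balls are cylinders, and for `q` of
norm `k ^ N` the condition `‖q A‖ < k ^ (N - t)` is a system of linear equations over `F` in the
first `t` digits (`distToPoly_lt_iff_near`).  Below depth `N` the solutions form a tree in which
every node has `k ^ ((m - 1) n)` children, while down to depth `N` there is no condition at all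
(`fiberCard_of_le`, `fiberCard_of_ge`).

*Upper bound.*  If `ψ(q) / |q| = k⁻ᵗ`, then the solutions for `q` are covered by
`k ^ (n N + n (m - 1) t)` cylinders of depth `t`, so that the series that defines `η(ψ)` is exactly
the one of the covering argument (`dimH_image_le_of_summable`, `dimH_approxSet_le_of_summable`).

*Lower bound.*  If the series with some exponent larger than `s` diverges, then by the pigeonhole
principle there are infinitely many pairs `(N, t)` for which at least `k ^ (s t - n N)` vectors `q`
of norm `k ^ N` have `ψ(q) / |q| ≥ k⁻ᵗ` (`hasManyVectors_of_not_summable`).  Let `U` be the union of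
the solution sets of these `q`.  The uniform measure on the pairs of such a `q` and a solution
for `q` has small energy: for two vectors `q`, `q'`, the number of common solutions is governed by
the number of relations `h q + h' q' = 0`, because the matrix of the two systems of equations has
the relations as its left kernel (`card_near_near`).  In such a relation `h'` divides the components
of `h q` and determines `q'`, so that the divisor bound in `F[X]` (`exists_ncard_dvd_le`) limits the
number of relations.  By the Cauchy-Schwarz inequality (`contentGE_of_energy`), the net content of
`U` in a cylinder is at least a constant times that of the cylinder, as soon as `N` is large
in terms of the depth (`exists_contentGE_nearSet`).  The constant improves to `1` as in Falconer's
theory of sets with large intersections (`contentGE_boost`).  Such sets, for a sequence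
of pairs `(N, t)`, can therefore be intersected successively without any loss of content, and
compactness passes to the limit (`one_le_tsum_of_cover`).
-/

/-! ### Net content on a tree of digit strings -/

namespace DigitSeq

variable {S : Type*}

/-- The first `b` digits of a digit sequence. -/
def pre (b : ℕ) (z : ℕ → S) : Fin b → S := fun i => z i

theorem pre_eq_iff {b : ℕ} {z w : ℕ → S} : pre b z = pre b w ↔ ∀ i < b, z i = w i :=
  ⟨fun h i hi => congrFun h ⟨i, hi⟩, fun h => funext fun i => h i i.2⟩

theorem pre_eq_of_le {a b : ℕ} (hab : a ≤ b) {z w : ℕ → S} (h : pre b z = pre b w) :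
    pre a z = pre a w :=
  pre_eq_iff.2 fun i hi => pre_eq_iff.1 h i (hi.trans_le hab)

/-- A node of the tree of finite digit strings: a length and a string of that length. -/
abbrev Node (S : Type*) := Σ b : ℕ, Fin b → S

/-- The cylinder of all digit sequences that start with a given string. -/
def Node.cyl (p : Node S) : Set (ℕ → S) := {z | pre p.1 z = p.2}

/-- Extension of a finite string by zeros. -/
def ext [Zero S] {l : ℕ} (s : Fin l → S) : ℕ → S := fun j => if h : j < l then s ⟨j, h⟩ else 0

theorem ext_of_lt [Zero S] {l : ℕ} (s : Fin l → S) {j : ℕ} (h : j < l) : ext s j = s ⟨j, h⟩ := by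
  simp [ext, h]

@[simp] theorem pre_ext [Zero S] {l : ℕ} (s : Fin l → S) : pre l (ext s) = s := by
  funext i
  simp [pre, ext]

/-- The set `V` is a union of cylinders of depth `b`. -/
def Saturated (b : ℕ) (V : Set (ℕ → S)) : Prop :=
  ∀ z w, pre b z = pre b w → z ∈ V → w ∈ V

theorem Saturated.mono {a b : ℕ} (hab : a ≤ b) {V : Set (ℕ → S)} (h : Saturated a V) :
    Saturated b V := fun z w hzw hz => h z w (pre_eq_of_le hab hzw) hz

theorem Saturated.inter {b : ℕ} {V U : Set (ℕ → S)} (hV : Saturated b V) (hU : Saturated b U) :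
    Saturated b (V ∩ U) := fun z w hzw hz => ⟨hV z w hzw hz.1, hU z w hzw hz.2⟩

/-- The net content of `V`, computed with finite covers by cylinders in which a cylinder of depth
`b` has weight `θ ^ b`, is at least `c`. -/
def ContentGE (θ c : ℝ) (V : Set (ℕ → S)) : Prop :=
  ∀ C : Finset (Node S), V ⊆ ⋃ p ∈ C, p.cyl → c ≤ ∑ p ∈ C, θ ^ p.1

open Classical in
/-- The nodes of `C` that lie strictly below the string `s`. -/
noncomputable def below (C : Finset (Node S)) {b : ℕ} (s : Fin b → S) : Finset (Node S) :=
  C.filter fun p => b < p.1 ∧ ∃ z ∈ p.cyl, pre b z = s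

open Classical in
theorem sum_below_le {θ : ℝ} (hθ : 0 < θ) (C : Finset (Node S)) {b : ℕ} (T : Finset (Fin b → S)) :
    ∑ s ∈ T, ∑ p ∈ below C s, θ ^ p.1 ≤ ∑ p ∈ C with b < p.1, θ ^ p.1 := by
  rw [← Finset.sum_biUnion]
  · refine Finset.sum_le_sum_of_subset_of_nonneg ?_ fun _ _ _ => by positivity
    intro p hp
    simp only [Finset.mem_biUnion, below, Finset.mem_filter] at hp ⊢
    obtain ⟨s, -, h1, h2, -⟩ := hp
    exact ⟨h1, h2⟩
  · intro s _ s' _ hss'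
    refine Finset.disjoint_left.2 fun p hp hp' => hss' ?_
    simp only [below, Finset.mem_filter] at hp hp'
    obtain ⟨-, h1, z, hz, rfl⟩ := hp
    obtain ⟨-, -, w, hw, rfl⟩ := hp'
    exact pre_eq_of_le h1.le (hz.trans hw.symm)

section Finite

variable [Fintype S]

open Classical in
/-- If `U` has full content in each depth-`b` cylinder of `V`, the parts of a cover of `V ∩ U`
that are deeper than `b` can be replaced by cylinders of depth `b`, at no cost. -/
theorem exists_cover_depth_le {θ : ℝ} (hθ : 0 < θ) {b : ℕ} {V U : Set (ℕ → S)}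
    (hV : Saturated b V)
    (hU : ∀ z ∈ V, ContentGE θ (θ ^ b) (U ∩ {w | pre b w = pre b z}))
    (C : Finset (Node S)) (hC : V ∩ U ⊆ ⋃ p ∈ C, p.cyl) :
    ∃ C' : Finset (Node S), (∀ p ∈ C', p.1 ≤ b) ∧ V ⊆ ⋃ p ∈ C', p.cyl ∧
      ∑ p ∈ C', θ ^ p.1 ≤ ∑ p ∈ C, θ ^ p.1 := by
  set T : Finset (Fin b → S) := Finset.univ.filter fun s =>
    (∃ z ∈ V, pre b z = s) ∧ ∀ z, pre b z = s → ∀ p ∈ C, p.1 ≤ b → z ∉ p.cyl with hT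
  refine ⟨C.filter (fun p => p.1 ≤ b) ∪ T.image fun s => ⟨b, s⟩, ?_, ?_, ?_⟩
  · intro p hp
    simp only [Finset.mem_union, Finset.mem_filter, Finset.mem_image] at hp
    rcases hp with hp | ⟨s, -, rfl⟩
    · exact hp.2
    · exact le_rfl
  · intro z hz
    simp only [Set.mem_iUnion]
    by_cases h : ∃ p ∈ C, p.1 ≤ b ∧ z ∈ p.cyl
    · obtain ⟨p, hp, hpb, hzp⟩ := h
      exact ⟨p, Finset.mem_union_left _ (Finset.mem_filter.2 ⟨hp, hpb⟩), hzp⟩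
    · refine ⟨⟨b, pre b z⟩, Finset.mem_union_right _ (Finset.mem_image.2 ⟨pre b z, ?_, rfl⟩), rfl⟩
      simp only [hT, Finset.mem_filter, Finset.mem_univ, true_and]
      refine ⟨⟨z, hz, rfl⟩, fun w hw p hp hpb hwp => h ⟨p, hp, hpb, ?_⟩⟩
      exact (pre_eq_of_le hpb hw.symm).trans hwp
  · have h1 : ∑ s ∈ T, θ ^ b ≤ ∑ s ∈ T, ∑ p ∈ below C s, θ ^ p.1 := by
      refine Finset.sum_le_sum fun s hs => ?_
      simp only [hT, Finset.mem_filter, Finset.mem_univ, true_and] at hs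
      obtain ⟨⟨z, hz, rfl⟩, hs⟩ := hs
      refine hU z hz _ fun w hw => ?_
      have hw' := hC ⟨hV z w hw.2.symm hz, hw.1⟩
      simp only [Set.mem_iUnion] at hw' ⊢
      obtain ⟨p, hp, hwp⟩ := hw'
      refine ⟨p, Finset.mem_filter.2 ⟨hp, ?_, w, hwp, hw.2⟩, hwp⟩
      by_contra hlt
      exact hs w hw.2 p hp (not_lt.1 hlt) hwp
    have h2 := h1.trans (sum_below_le hθ C T)
    have h3 : ∑ p ∈ T.image (fun s => (⟨b, s⟩ : Node S)), θ ^ p.1 ≤ ∑ s ∈ T, θ ^ b := by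
      rw [Finset.sum_image]
      intro s _ s' _ h
      simpa using h
    have h4 := Finset.sum_filter_add_sum_filter_not C (fun p => p.1 ≤ b) fun p => θ ^ p.1
    simp only [not_le] at h4
    have h5 := Finset.sum_union_inter (s₁ := C.filter (fun p => p.1 ≤ b))
      (s₂ := T.image fun s => (⟨b, s⟩ : Node S)) (f := fun p => θ ^ p.1)
    have h6 : 0 ≤ ∑ p ∈ C.filter (fun p => p.1 ≤ b) ∩ T.image fun s => (⟨b, s⟩ : Node S),
        θ ^ p.1 := Finset.sum_nonneg fun _ _ => by positivity
    linarith

open Classical in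
theorem card_ext_pre_eq [Zero S] {a J : ℕ} (u : Fin a → S) :
    (Finset.univ.filter fun s : Fin (a + J) → S => pre a (ext s) = u).card
      = Fintype.card S ^ J := by
  have : (Finset.univ.filter fun s : Fin (a + J) → S => pre a (ext s) = u)
      = Finset.univ.image fun v : Fin J → S => Fin.append u v := by
    ext s
    simp only [Finset.mem_filter, Finset.mem_univ, true_and, Finset.mem_image]
    constructor
    · rintro rfl
      refine ⟨fun i => s (Fin.natAdd a i), ?_⟩
      conv_rhs => rw [← Fin.append_castAdd_natAdd (f := s)]
      congr 1
      funext i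
      have : (i : ℕ) < a + J := by omega
      simp [pre, ext, this]
      rfl
    · rintro ⟨v, rfl⟩
      funext i
      have : (i : ℕ) < a + J := by omega
      simp only [pre, ext, this, dite_true]
      exact Fin.append_left u v i
  rw [this, Finset.card_image_of_injective]
  · simp
  · intro v w h
    funext i
    have := congrFun h (Fin.natAdd a i)
    simpa using this

open Classical in
/-- A lower bound for the weight of a family of cylinders, one cylinder at a time: cylinders of
depth between `b` and `b + J` count by their mass, and the strings of length `b + J` that they
miss count through the deeper cylinders below them. -/
theorem pow_le_sum_of_uncovered [Zero S] {θ c : ℝ} (hθ : 0 < θ) (hθ1 : θ ≤ 1)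
    (hκ : 1 ≤ Fintype.card S * θ) {J : ℕ} (hc : 1 ≤ c * (Fintype.card S * θ) ^ J)
    (x : ℕ → S) (b : ℕ) (C : Finset (Node S))
    (hC : ∀ s : Fin (b + J) → S, pre b (ext s) = pre b x →
      (∀ p ∈ C, p.1 ≤ b + J → ext s ∉ p.cyl) → c * θ ^ (b + J) ≤ ∑ p ∈ below C s, θ ^ p.1) :
    θ ^ b ≤ ∑ p ∈ C, θ ^ p.1 := by
  by_cases hbig : ∃ p ∈ C, p.1 ≤ b ∧ x ∈ p.cyl
  · obtain ⟨p, hp, hpb, -⟩ := hbig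
    exact (pow_le_pow_of_le_one hθ.le hθ1 hpb).trans
      (Finset.single_le_sum (f := fun p : Node S => θ ^ p.1) (fun _ _ => by positivity) hp)
  set κ : ℝ := (Fintype.card S : ℝ) with hκdef
  have hκ0 : 0 < κ := by
    by_contra h
    have : κ * θ ≤ 0 := mul_nonpos_of_nonpos_of_nonneg (not_lt.1 h) hθ.le
    linarith
  set T : Finset (Fin (b + J) → S) := Finset.univ.filter fun s => pre b (ext s) = pre b x with hT
  have hTcard : (T.card : ℝ) = κ ^ J := by
    rw [hT, card_ext_pre_eq]
    simp [hκdef]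
  set P : (Fin (b + J) → S) → Prop := fun s => ∃ p ∈ C, p.1 ≤ b + J ∧ ext s ∈ p.cyl with hP
  have hsplit := Finset.card_filter_add_card_filter_not (s := T) P
  have h1 : ((T.filter P).card : ℝ) ≤
      ∑ p ∈ C with p.1 ≤ b + J, (if b < p.1 then κ ^ (b + J - p.1) else 0) := by
    have hsub : T.filter P ⊆ (C.filter fun p => p.1 ≤ b + J).biUnion
        fun p => T.filter fun s => ext s ∈ p.cyl := by
      intro s hs
      simp only [hP, Finset.mem_filter, Finset.mem_biUnion] at hs ⊢
      obtain ⟨hs, p, hp, hpb, hsp⟩ := hs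
      exact ⟨p, ⟨hp, hpb⟩, hs, hsp⟩
    refine (Nat.cast_le.2 ((Finset.card_le_card hsub).trans Finset.card_biUnion_le)).trans ?_
    rw [Nat.cast_sum]
    refine Finset.sum_le_sum fun p hp => ?_
    obtain ⟨hp, hpb⟩ := Finset.mem_filter.1 hp
    split_ifs with hbp
    · have hle : (T.filter fun s => ext s ∈ p.cyl).card ≤ Fintype.card S ^ (b + J - p.1) := by
        obtain ⟨e, he⟩ := Nat.exists_eq_add_of_le hpb
        have := card_ext_pre_eq (S := S) (J := e) p.2
        rw [show b + J - p.1 = e by omega, ← this]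
        have key : ∀ L : ℕ, L = p.1 + e → ∀ T : Finset (Fin L → S),
            (T.filter fun s => ext s ∈ p.cyl).card ≤ (Finset.univ.filter
              fun s : Fin (p.1 + e) → S => pre p.1 (ext s) = p.2).card := by
          rintro L rfl T
          refine Finset.card_le_card fun s hs => ?_
          simp only [Finset.mem_filter, Finset.mem_univ, true_and] at hs ⊢
          exact hs.2
        exact key _ he T
      rw [hκdef]
      exact_mod_cast hle
    · rw [Finset.card_eq_zero.2]
      · simp
      · refine Finset.filter_eq_empty_iff.2 fun s hs hsp => hbig ⟨p, hp, not_lt.1 hbp, ?_⟩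
        exact (pre_eq_of_le (not_lt.1 hbp) (Finset.mem_filter.1 hs).2.symm).trans hsp
  have h2 : ((T.filter fun s => ¬ P s).card : ℝ) * (c * θ ^ (b + J))
      ≤ ∑ p ∈ C with b + J < p.1, θ ^ p.1 := by
    rw [← nsmul_eq_mul, ← Finset.sum_const]
    refine (Finset.sum_le_sum fun s hs => ?_).trans (sum_below_le hθ C (T.filter fun s => ¬ P s))
    simp only [hP, hT, Finset.mem_filter, Finset.mem_univ, true_and] at hs
    exact hC s hs.1 fun p hp hpb hsp => hs.2 ⟨p, hp, hpb, hsp⟩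
  have h3 : (θ ^ b / κ ^ J) * ∑ p ∈ C with p.1 ≤ b + J, (if b < p.1 then κ ^ (b + J - p.1) else 0)
      ≤ ∑ p ∈ C with p.1 ≤ b + J, θ ^ p.1 := by
    rw [Finset.mul_sum]
    refine Finset.sum_le_sum fun p hp => ?_
    split_ifs with hbp
    · obtain ⟨e, he⟩ := Nat.exists_eq_add_of_le hbp.le
      obtain ⟨f, hf⟩ := Nat.exists_eq_add_of_le (Finset.mem_filter.1 hp).2
      have hJ : J = e + f := by omega
      rw [show b + J - p.1 = f by omega, he, hJ, pow_add, pow_add]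
      have := one_le_pow₀ hκ (n := e)
      rw [mul_pow] at this
      have hpos : 0 < κ ^ e * κ ^ f := by positivity
      rw [div_mul_eq_mul_div, div_le_iff₀ hpos]
      have hq : 0 < θ ^ b * κ ^ f := by positivity
      nlinarith
    · rw [mul_zero]; positivity
  have h4 : θ ^ b / κ ^ J ≤ c * θ ^ (b + J) := by
    rw [div_le_iff₀ (by positivity), pow_add]
    rw [mul_pow] at hc
    have : 0 < θ ^ b := by positivity
    nlinarith
  have h5 := Finset.sum_filter_add_sum_filter_not C (fun p => p.1 ≤ b + J) fun p => θ ^ p.1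
  simp only [not_le] at h5
  have h6 : (θ ^ b / κ ^ J) * ((T.filter P).card : ℝ) ≤ ∑ p ∈ C with p.1 ≤ b + J, θ ^ p.1 :=
    (mul_le_mul_of_nonneg_left h1 (by positivity)).trans h3
  have h7 : (θ ^ b / κ ^ J) * ((T.filter fun s => ¬ P s).card : ℝ)
      ≤ ∑ p ∈ C with b + J < p.1, θ ^ p.1 := by
    rw [mul_comm]
    exact (mul_le_mul_of_nonneg_left h4 (by positivity)).trans h2
  have h8 : ((T.filter P).card : ℝ) + ((T.filter fun s => ¬ P s).card : ℝ) = κ ^ J := by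
    rw [← hTcard, ← hsplit]
    push_cast
    rfl
  have h9 : θ ^ b = (θ ^ b / κ ^ J) * κ ^ J := by
    field_simp
  rw [h9]
  nth_rewrite 2 [← h8]
  rw [mul_add]
  linarith

theorem contentGE_cyl [Zero S] {θ : ℝ} (hθ : 0 < θ) (hθ1 : θ ≤ 1)
    (hκ : 1 ≤ Fintype.card S * θ) (x : ℕ → S) (b : ℕ) :
    ContentGE θ (θ ^ b) {w | pre b w = pre b x} := by
  intro C hC
  refine pow_le_sum_of_uncovered hθ hθ1 hκ (J := C.sup fun p => p.1) (c := 1) ?_ x b C ?_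
  · rw [one_mul]
    exact one_le_pow₀ hκ
  · intro s hs h
    have := hC hs
    simp only [Set.mem_iUnion] at this
    obtain ⟨p, hp, hsp⟩ := this
    exact absurd hsp (h p hp
      ((Finset.le_sup (f := fun p : Node S => p.1) hp).trans (Nat.le_add_left _ _)))

/-- Falconer's observation that a uniform lower bound for the content in small cylinders improves
itself: if `U` has content at least `c θ ^ (b + J)` in all depth-`(b + J)` cylinders below a
cylinder of depth `b`, and `J` is large in terms of `c`, then `U` has there the content of the
whole cylinder. -/
theorem contentGE_boost [Zero S] {θ c : ℝ} (hθ : 0 < θ) (hθ1 : θ ≤ 1)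
    (hκ : 1 ≤ Fintype.card S * θ) {J : ℕ} (hc : 1 ≤ c * (Fintype.card S * θ) ^ J)
    (x : ℕ → S) (b : ℕ) {U : Set (ℕ → S)}
    (hU : ∀ y, pre b y = pre b x →
      ContentGE θ (c * θ ^ (b + J)) (U ∩ {w | pre (b + J) w = pre (b + J) y})) :
    ContentGE θ (θ ^ b) (U ∩ {w | pre b w = pre b x}) := by
  intro C hC
  refine pow_le_sum_of_uncovered hθ hθ1 hκ hc x b C fun s hs h => ?_
  refine hU _ hs _ fun w hw => ?_
  have hw2 : pre (b + J) w = s := hw.2.trans (pre_ext s)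
  have := hC ⟨hw.1, (pre_eq_of_le (Nat.le_add_right _ _) hw.2).trans hs⟩
  simp only [Set.mem_iUnion] at this ⊢
  obtain ⟨p, hp, hwp⟩ := this
  classical
  refine ⟨p, Finset.mem_filter.2 ⟨hp, ?_, w, hwp, hw2⟩, hwp⟩
  by_contra hlt
  exact h p hp (not_lt.1 hlt) ((pre_eq_of_le (not_lt.1 hlt) hw.2.symm).trans hwp)

open Classical in
/-- The energy method: a lower bound for the content of a set that contains the depth-`t`
cylinders of a family of points, from the number of pairs of these points that share `l` digits.
The proof is the Cauchy-Schwarz inequality. -/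
theorem contentGE_of_energy [Zero S] {θ : ℝ} (hθ : 0 < θ) (hθ1 : θ ≤ 1)
    (hκ : 1 ≤ Fintype.card S * θ) {α : Type*} (Ω : Finset α) (hΩ : Ω.Nonempty) (π : α → ℕ → S)
    {t : ℕ} {U : Set (ℕ → S)} (hU : ∀ ω ∈ Ω, {w | pre t w = pre t (π ω)} ⊆ U) {B : ℝ} (hB : 0 < B)
    (hE : ∑ l ∈ Finset.range (t + 1),
      ∑ s : Fin l → S, ((Ω.filter fun ω => pre l (π ω) = s).card : ℝ) ^ 2 / θ ^ l
        ≤ B * (Ω.card : ℝ) ^ 2) :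
    ContentGE θ (1 / B) U := by
  intro C hC
  set V : Set (ℕ → S) := {z | ∃ ω ∈ Ω, pre t z = pre t (π ω)} with hV
  have hVU : V ⊆ U := by
    rintro z ⟨ω, hω, h⟩
    exact hU ω hω h
  obtain ⟨C', hC't, hC'V, hC'C⟩ := exists_cover_depth_le (b := t) (V := V) (U := Set.univ) hθ
    (by rintro z w hzw ⟨ω, hω, h⟩; exact ⟨ω, hω, hzw.symm.trans h⟩)
    (fun z _ => by rw [Set.univ_inter]; exact contentGE_cyl hθ hθ1 hκ z t) C
    (by rw [Set.inter_univ]; exact hVU.trans hC)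
  refine le_trans ?_ hC'C
  set n : Node S → ℝ := fun p => ((Ω.filter fun ω => pre p.1 (π ω) = p.2).card : ℝ) with hn
  have h1 : (Ω.card : ℝ) ≤ ∑ p ∈ C', n p := by
    have hsub : Ω ⊆ C'.biUnion fun p => Ω.filter fun ω => pre p.1 (π ω) = p.2 := by
      intro ω hω
      have := hC'V (show π ω ∈ V from ⟨ω, hω, rfl⟩)
      simp only [Set.mem_iUnion] at this
      obtain ⟨p, hp, hωp⟩ := this
      exact Finset.mem_biUnion.2 ⟨p, hp, Finset.mem_filter.2 ⟨hω, hωp⟩⟩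
    simp only [hn]
    exact_mod_cast (Finset.card_le_card hsub).trans Finset.card_biUnion_le
  have h2 : (∑ p ∈ C', n p) ^ 2 ≤ (∑ p ∈ C', θ ^ p.1) * ∑ p ∈ C', n p ^ 2 / θ ^ p.1 := by
    refine Finset.sum_sq_le_sum_mul_sum_of_sq_le_mul C' (fun _ _ => by positivity)
      (fun _ _ => by positivity) fun p _ => ?_
    rw [mul_div_cancel₀ _ (by positivity)]
  have h3 : ∑ p ∈ C', n p ^ 2 / θ ^ p.1 ≤ B * (Ω.card : ℝ) ^ 2 := by
    refine le_trans ?_ hE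
    rw [← Finset.sum_sigma (Finset.range (t + 1)) (fun l => (Finset.univ : Finset (Fin l → S)))
      (fun p => n p ^ 2 / θ ^ p.1)]
    refine Finset.sum_le_sum_of_subset_of_nonneg (fun p hp => ?_) fun _ _ _ => by positivity
    simp only [Finset.mem_sigma, Finset.mem_range, Finset.mem_univ, and_true]
    exact Nat.lt_succ_of_le (hC't p hp)
  have hpos : (0 : ℝ) < (Ω.card : ℝ) := by exact_mod_cast hΩ.card_pos
  have hs : 0 ≤ ∑ p ∈ C', θ ^ p.1 := Finset.sum_nonneg fun _ _ => by positivity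
  have h4 : (Ω.card : ℝ) ^ 2 ≤ (∑ p ∈ C', θ ^ p.1) * (B * (Ω.card : ℝ) ^ 2) :=
    (pow_le_pow_left₀ hpos.le h1 2).trans (h2.trans (mul_le_mul_of_nonneg_left h3 hs))
  rw [div_le_iff₀ hB]
  have h5 : 0 < (Ω.card : ℝ) ^ 2 := by positivity
  nlinarith

/-- Countable intersections.  Suppose that each `O j` contains, for every depth `b`, a saturated
set that has full content in all cylinders of depth `b`.  Then every countable cover of the
intersection of the `O j` by cylinders weighs at least as much as the whole space. -/
theorem one_le_tsum_of_cover [Zero S] {θ : ℝ} (hθ : 0 < θ) (hθ1 : θ ≤ 1)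
    (hκ : 1 ≤ Fintype.card S * θ) (O : ℕ → Set (ℕ → S))
    (hO : ∀ j b, ∃ t, ∃ U ⊆ O j, b ≤ t ∧ Saturated t U ∧
      ∀ x, ContentGE θ (θ ^ b) (U ∩ {w | pre b w = pre b x}))
    (p : ℕ → Node S) (hp : ⋂ j, O j ⊆ ⋃ i, (p i).cyl) :
    1 ≤ ∑' i, ENNReal.ofReal (θ ^ (p i).1) := by
  choose tt UU hUO hbt hsat hcont using hO
  -- `W j` is the stage-`j` set together with a depth at which it is saturated
  let W : ℕ → Set (ℕ → S) × ℕ := fun j => Nat.rec (Set.univ, 0)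
    (fun j V => (V.1 ∩ UU j V.2, tt j V.2)) j
  have hWs : ∀ j, W (j + 1) = ((W j).1 ∩ UU j (W j).2, tt j (W j).2) := fun j => rfl
  have hWsat : ∀ j, Saturated (W j).2 (W j).1 := by
    intro j
    induction j with
    | zero => intro z w _ _; trivial
    | succ j ih =>
      rw [hWs]
      exact (ih.mono (hbt _ _)).inter (hsat _ _)
  have hWcont : ∀ j, ContentGE θ 1 (W j).1 := by
    intro j
    induction j with
    | zero =>
      have := contentGE_cyl (S := S) hθ hθ1 hκ (fun _ => 0) 0
      rw [pow_zero] at this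
      intro C hC
      exact this C fun z _ => hC trivial
    | succ j ih =>
      intro C hC
      rw [hWs] at hC
      obtain ⟨C', -, h2, h3⟩ := exists_cover_depth_le hθ (hWsat j)
        (fun z _ => hcont j (W j).2 z) C hC
      exact (ih C' h2).trans h3
  let _ : TopologicalSpace S := ⊥
  have : DiscreteTopology S := ⟨rfl⟩
  have hopen : ∀ q : Node S, IsOpen q.cyl := by
    intro q
    have : Continuous (pre q.1 : (ℕ → S) → Fin q.1 → S) :=
      continuous_pi fun i => continuous_apply (i : ℕ)
    exact (isOpen_discrete {q.2}).preimage this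
  have hsatclosed : ∀ (b : ℕ) (V : Set (ℕ → S)), Saturated b V → IsClosed V := by
    intro b V hV
    have : Continuous (pre b : (ℕ → S) → Fin b → S) :=
      continuous_pi fun i => continuous_apply (i : ℕ)
    have h : V = pre b ⁻¹' (pre b '' V) := by
      ext z
      refine ⟨fun hz => ⟨z, hz, rfl⟩, ?_⟩
      rintro ⟨w, hw, hwz⟩
      exact hV w z hwz hw
    rw [h]
    exact (isClosed_discrete _).preimage this
  have hanti : Antitone fun j => (W j).1 := antitone_nat_of_succ_le fun j => by
    rw [hWs]; exact Set.inter_subset_left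
  have hK : ⋂ j, (W j).1 ⊆ ⋃ i, (p i).cyl := by
    refine subset_trans (fun z hz => Set.mem_iInter.2 fun j => ?_) hp
    have := Set.mem_iInter.1 hz (j + 1)
    rw [hWs] at this
    exact hUO _ _ this.2
  have hcl : ∀ j, IsClosed (W j).1 := fun j => hsatclosed _ _ (hWsat j)
  obtain ⟨I, hI⟩ := (isClosed_iInter hcl).isCompact.elim_finite_subcover _ (fun i => hopen (p i)) hK
  obtain ⟨j, hj⟩ := exists_subset_nhds_of_isCompact' hanti.directed_ge
    (fun j => (hcl j).isCompact) hcl (U := ⋃ i ∈ I, (p i).cyl) fun z hz =>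
      (isOpen_biUnion fun i _ => hopen (p i)).mem_nhds (hI hz)
  classical
  have h1 : (1 : ℝ) ≤ ∑ i ∈ I, θ ^ (p i).1 := by
    refine (hWcont j (I.image p) ?_).trans ?_
    · refine hj.trans fun z hz => ?_
      simp only [Set.mem_iUnion] at hz ⊢
      obtain ⟨i, hi, hzi⟩ := hz
      exact ⟨p i, Finset.mem_image_of_mem p hi, hzi⟩
    · exact Finset.sum_image_le_of_nonneg (f := fun q : Node S => θ ^ q.1) fun _ _ => by positivity
  calc (1 : ℝ≥0∞) = ENNReal.ofReal 1 := by simp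
    _ ≤ ENNReal.ofReal (∑ i ∈ I, θ ^ (p i).1) := ENNReal.ofReal_le_ofReal h1
    _ = ∑ i ∈ I, ENNReal.ofReal (θ ^ (p i).1) :=
      ENNReal.ofReal_sum_of_nonneg fun _ _ => by positivity
    _ ≤ _ := ENNReal.sum_le_tsum I

end Finite

end DigitSeq

/-! ### The divisor bound for polynomials over a finite field -/

namespace Polynomial

open UniqueFactorizationMonoid

theorem finite_dvd {F : Type*} [Field F] [Finite F] {f : F[X]} (hf : f ≠ 0) :
    {h : F[X] | h ∣ f}.Finite := by
  have : Finite (degreeLT F (f.natDegree + 1)) := 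
    Finite.of_equiv _ (degreeLTEquiv F (f.natDegree + 1)).symm.toEquiv
  refine (Set.toFinite (degreeLT F (f.natDegree + 1) : Set F[X])).subset fun h hh => ?_
  rw [SetLike.mem_coe, mem_degreeLT]
  have := natDegree_le_of_dvd hh hf
  exact (degree_le_natDegree).trans_lt (by exact_mod_cast Nat.lt_succ_of_le this)

open Classical in
theorem ncard_dvd_le {F : Type*} [Field F] [Finite F] {f : F[X]} (hf : f ≠ 0) :
    {h : F[X] | h ∣ f}.ncard ≤ Nat.card F *
      ∏ P ∈ (normalizedFactors f).toFinset, ((normalizedFactors f).count P + 1) := by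
  rw [← Multiset.card_Iic]
  have : Fintype F := Fintype.ofFinite F
  rw [Nat.card_eq_fintype_card, ← Finset.card_univ, ← Finset.card_product, ← Set.ncard_coe_finset]
  refine Set.ncard_le_ncard_of_injOn (fun h => (h.leadingCoeff, normalizedFactors h)) ?_ ?_
    (Finset.finite_toSet _)
  · intro h hh
    have h0 : h ≠ 0 := ne_zero_of_dvd_ne_zero hf hh
    simp only [Finset.coe_product, Set.mem_prod, Finset.coe_univ, Set.mem_univ, true_and,
      Finset.mem_coe, Finset.mem_Iic]
    exact (dvd_iff_normalizedFactors_le_normalizedFactors h0 hf).1 hh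
  · intro a ha b hb hab
    have ha0 : a ≠ 0 := ne_zero_of_dvd_ne_zero hf ha
    have hb0 : b ≠ 0 := ne_zero_of_dvd_ne_zero hf hb
    obtain ⟨h1, h2⟩ := Prod.mk.inj hab
    have h3 := (associated_iff_normalizedFactors_eq_normalizedFactors ha0 hb0).2 h2
    obtain ⟨u, hu⟩ := h3
    obtain ⟨r, hr, hru⟩ := Polynomial.isUnit_iff.1 u.isUnit
    rw [← hru] at hu
    have h4 : a.leadingCoeff * r = b.leadingCoeff := by rw [← hu]; simp
    rw [← h1] at h4
    have : r = 1 := mul_left_cancel₀ (leadingCoeff_ne_zero.2 ha0) (by rw [h4, mul_one])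
    rw [← hu, this]; simp

open Classical in
theorem sum_count_mul_natDegree {F : Type*} [Field F] {f : F[X]} (hf : f ≠ 0) :
    ∑ P ∈ (normalizedFactors f).toFinset, (normalizedFactors f).count P * P.natDegree
      = f.natDegree := by
  have h := natDegree_eq_of_degree_eq
    (degree_eq_degree_of_associated (prod_normalizedFactors hf))
  rw [← h, natDegree_multiset_prod _ (zero_notMem_normalizedFactors f),
    Finset.sum_multiset_map_count]
  simp

/-- The divisor bound in `F[X]`: a polynomial of degree `d` has `O(k ^ (ε d))` divisors, for every
`ε > 0`. -/
theorem exists_ncard_dvd_le (F : Type*) [Field F] [Finite F] {ε : ℝ} (hε : 0 < ε) :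
    ∃ K : ℝ, 0 < K ∧ ∀ f : F[X], f ≠ 0 →
      ({h : F[X] | h ∣ f}.ncard : ℝ) ≤ K * (Nat.card F : ℝ) ^ (ε * f.natDegree) := by
  classical
  set k : ℝ := (Nat.card F : ℝ) with hk
  have hk1 : 1 < k := by rw [hk]; exact_mod_cast Finite.one_lt_card
  have hk0 : 0 < k := by linarith
  -- from degree `D` on, `2 ≤ k ^ (ε D)`, so that `a + 1 ≤ 2 ^ a ≤ k ^ (ε a deg P)`
  obtain ⟨D, hD⟩ : ∃ D : ℕ, 2 ≤ k ^ (ε * D) := by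
    have h1 : 1 < k ^ ε := Real.one_lt_rpow hk1 hε
    obtain ⟨D, hD⟩ := pow_unbounded_of_one_lt 2 h1
    exact ⟨D, by rw [Real.rpow_mul hk0.le, Real.rpow_natCast]; exact hD.le⟩
  -- for all positive degrees, `a + 1 ≤ M k ^ (ε a)`
  obtain ⟨M, hM1, hM⟩ : ∃ M : ℝ, 1 ≤ M ∧ ∀ a : ℕ, (a : ℝ) + 1 ≤ M * k ^ (ε * a) := by
    have hl : 0 < ε * Real.log k := mul_pos hε (Real.log_pos hk1)
    refine ⟨max 1 (1 / (ε * Real.log k)), le_max_left _ _, fun a => ?_⟩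
    have h1 : k ^ (ε * a) = Real.exp (ε * Real.log k * a) := by
      rw [Real.rpow_def_of_pos hk0]; ring_nf
    have h2 := Real.add_one_le_exp (ε * Real.log k * a)
    rw [h1]
    have h3 : (a : ℝ) = 1 / (ε * Real.log k) * (ε * Real.log k * a) := by
      have h5 := (Real.log_pos hk1).ne'
      field_simp
    have h4 : 0 ≤ ε * Real.log k * a := by positivity
    calc (a : ℝ) + 1 = 1 / (ε * Real.log k) * (ε * Real.log k * a) + 1 := by rw [← h3]
      _ ≤ max 1 (1 / (ε * Real.log k)) * (ε * Real.log k * a) + max 1 (1 / (ε * Real.log k)) :=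
        add_le_add (mul_le_mul_of_nonneg_right (le_max_right _ _) h4) (le_max_left _ _)
      _ = max 1 (1 / (ε * Real.log k)) * (ε * Real.log k * a + 1) := by ring
      _ ≤ _ := mul_le_mul_of_nonneg_left h2 (by positivity)
  have hfin : ((degreeLT F D : Submodule F F[X]) : Set F[X]).Finite := by
    have : Finite (degreeLT F D) := Finite.of_equiv _ (degreeLTEquiv F D).symm.toEquiv
    exact Set.toFinite _
  refine ⟨k * M ^ hfin.toFinset.card, by positivity, fun f hf => ?_⟩
  set T := (normalizedFactors f).toFinset with hT
  set a : F[X] → ℕ := fun P => (normalizedFactors f).count P with ha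
  have h1 : ∀ P ∈ T, (a P : ℝ) + 1 ≤
      (if P.natDegree < D then M else 1) * k ^ (ε * (a P * P.natDegree : ℕ)) := by
    intro P hP
    have hPirr := irreducible_of_normalized_factor P (Multiset.mem_toFinset.1 hP)
    have hdeg : 1 ≤ P.natDegree := hPirr.natDegree_pos
    split_ifs with hPD
    · refine (hM (a P)).trans (mul_le_mul_of_nonneg_left ?_ (by linarith))
      refine Real.rpow_le_rpow_of_exponent_le hk1.le (mul_le_mul_of_nonneg_left ?_ hε.le)
      exact_mod_cast Nat.le_mul_of_pos_right _ hdeg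
    · rw [one_mul]
      have h2 : (a P : ℝ) + 1 ≤ 2 ^ a P := by exact_mod_cast Nat.lt_two_pow_self
      refine h2.trans ((pow_le_pow_left₀ (by norm_num) hD (a P)).trans ?_)
      rw [← Real.rpow_natCast, ← Real.rpow_mul hk0.le]
      refine Real.rpow_le_rpow_of_exponent_le hk1.le ?_
      push_cast
      have : (D : ℝ) ≤ P.natDegree := by exact_mod_cast not_lt.1 hPD
      have h3 : 0 ≤ ε * a P := by positivity
      nlinarith
  have h2 : (∏ P ∈ T, ((a P : ℝ) + 1)) ≤
      M ^ hfin.toFinset.card * k ^ (ε * f.natDegree) := by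
    refine (Finset.prod_le_prod (fun _ _ => by positivity) h1).trans ?_
    rw [Finset.prod_mul_distrib]
    have h3 : ∏ P ∈ T, k ^ (ε * (a P * P.natDegree : ℕ)) = k ^ (ε * f.natDegree) := by
      rw [← Real.rpow_sum_of_pos hk0, ← Finset.mul_sum, ← Nat.cast_sum,
        sum_count_mul_natDegree hf]
    rw [h3]
    refine mul_le_mul_of_nonneg_right ?_ (by positivity)
    rw [Finset.prod_ite]
    simp only [Finset.prod_const, one_pow, mul_one]
    refine pow_le_pow_right₀ hM1 (Finset.card_le_card fun P hP => ?_)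
    rw [Finset.mem_filter] at hP
    rw [Set.Finite.mem_toFinset, SetLike.mem_coe, mem_degreeLT]
    exact degree_le_natDegree.trans_lt (by exact_mod_cast hP.2)
  have h4 : ({h : F[X] | h ∣ f}.ncard : ℝ) ≤ k * ∏ P ∈ T, ((a P : ℝ) + 1) := by
    have := ncard_dvd_le hf
    rw [hk]
    exact_mod_cast this
  calc _ ≤ _ := h4
    _ ≤ k * (M ^ hfin.toFinset.card * k ^ (ε * f.natDegree)) :=
      mul_le_mul_of_nonneg_left h2 hk0.le
    _ = _ := by ring

end Polynomial

/-! ### Counting the solutions of the linear equations in the digits -/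

namespace DigitSeq

variable {F : Type*} [Field F] {m n : ℕ}

/-- The coefficient of `X⁻ᵈ⁻¹` in column `c` of `q A`, where `A` is the matrix with digits `z` (the
`j`-th digit being the matrix of the coefficients of `X⁻ʲ⁻¹`) and `q` has degree at most `N`. -/
def fracCoeff (N : ℕ) (q : Fin m → F[X]) (z : ℕ → Fin m → Fin n → F) (c : Fin n) (d : ℕ) : F :=
  ∑ i, ∑ e ∈ Finset.range (N + 1), (q i).coeff e * z (e + d) i c

/-- The first `L` coefficients after the point vanish in each column of `q A`; here `z` is
the sequence of digits of `A`.  In other words, `‖q A‖ < k⁻ᴸ`. -/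
def Near (N : ℕ) (q : Fin m → F[X]) (L : ℕ) (z : ℕ → Fin m → Fin n → F) : Prop :=
  ∀ c, ∀ d < L, fracCoeff N q z c d = 0

theorem fracCoeff_congr {N : ℕ} (q : Fin m → F[X]) {z w : ℕ → Fin m → Fin n → F} (c : Fin n)
    {d : ℕ} (h : ∀ j ≤ N + d, z j = w j) : fracCoeff N q z c d = fracCoeff N q w c d := by
  refine Finset.sum_congr rfl fun i _ => Finset.sum_congr rfl fun e he => ?_
  rw [h _ (by have := Finset.mem_range.1 he; omega)]

theorem Near.congr {N L t : ℕ} (ht : N + L ≤ t) {q : Fin m → F[X]}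
    {z w : ℕ → Fin m → Fin n → F} (h : pre t z = pre t w) (hz : Near N q L z) : Near N q L w := by
  intro c d hd
  rw [← hz c d hd]
  exact fracCoeff_congr q c fun j hj => (pre_eq_iff.1 h j (by omega)).symm

/-- The set of digit sequences of the matrices `A` with `‖q A‖ < k⁻ᴸ` for some `q ∈ Q`. -/
def nearSet (N : ℕ) (Q : Finset (Fin m → F[X])) (L : ℕ) : Set (ℕ → Fin m → Fin n → F) :=
  {z | ∃ q ∈ Q, Near N q L z}

theorem saturated_nearSet (N : ℕ) (Q : Finset (Fin m → F[X])) {L t : ℕ} (ht : N + L ≤ t) :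
    Saturated t (nearSet (n := n) N Q L) := by
  rintro z w hzw ⟨q, hq, h⟩
  exact ⟨q, hq, h.congr ht hzw⟩

/-- The vector `q` of polynomials has norm `k ^ N`. -/
def HasDegree (N : ℕ) (q : Fin m → F[X]) : Prop :=
  (∀ i, (q i).natDegree ≤ N) ∧ ∃ i, (q i).coeff N ≠ 0

/-- The polynomial with given coefficients. -/
noncomputable def toPoly {L : ℕ} (a : Fin L → F) : F[X] := ∑ d : Fin L, C (a d) * X ^ (d : ℕ)

theorem coeff_toPoly {L : ℕ} (a : Fin L → F) (d : Fin L) : (toPoly a).coeff d = a d := by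
  simp only [toPoly, finsetSum_coeff, coeff_C_mul, coeff_X_pow]
  rw [Finset.sum_eq_single d]
  · simp
  · intro b _ hb
    rw [if_neg (fun h => hb (Fin.ext h.symm)), mul_zero]
  · simp

theorem toPoly_injective {L : ℕ} : Function.Injective (toPoly : (Fin L → F) → F[X]) := by
  intro a b h
  funext d
  rw [← coeff_toPoly a d, h, coeff_toPoly]

theorem coeff_toPoly_mul_eq_zero {N L : ℕ} (a : Fin L → F) {p : F[X]} (hp : p.natDegree ≤ N)
    {j : ℕ} (hj : N + L ≤ j) : (toPoly a * p).coeff j = 0 := by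
  rw [toPoly, Finset.sum_mul, finsetSum_coeff]
  refine Finset.sum_eq_zero fun d _ => ?_
  rw [mul_assoc, coeff_C_mul, mul_comm (X ^ (d : ℕ)), coeff_mul_X_pow']
  have := d.2
  rw [if_pos (by omega), coeff_eq_zero_of_natDegree_lt (by omega), mul_zero]

theorem eq_of_relation {L : ℕ} {q q' : Fin m → F[X]} (hq' : q' ≠ 0) {a b b' : Fin L → F}
    (h : ∀ i, toPoly a * q i + toPoly b * q' i = 0)
    (h' : ∀ i, toPoly a * q i + toPoly b' * q' i = 0) : b = b' := by
  obtain ⟨i, hi⟩ := Function.ne_iff.1 hq'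
  exact toPoly_injective (mul_right_cancel₀ hi (add_left_cancel ((h i).trans (h' i).symm)))

/-- The number of relations `h q + h' q' = 0` with polynomials `h`, `h'` of degree less than `L`. -/
noncomputable def relCard (L : ℕ) (q q' : Fin m → F[X]) : ℕ :=
  Nat.card {w : (Fin L → F) × (Fin L → F) // ∀ i, toPoly w.1 * q i + toPoly w.2 * q' i = 0}

/-- The matrix, in the first `l` digits of a column of `A`, of the equations for `‖q A‖ < k⁻ᴸ`. -/
def fracMatrix (L l : ℕ) (q : Fin m → F[X]) : Matrix (Fin L) (Fin l × Fin m) F :=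
  fun d p => if (d : ℕ) ≤ p.1 then (q p.2).coeff (p.1 - d) else 0

theorem fracMatrix_mulVec {N L : ℕ} {q : Fin m → F[X]} (hq : ∀ i, (q i).natDegree ≤ N)
    (s : Fin (N + L) → Fin m → Fin n → F) (c : Fin n) (d : Fin L) :
    (fracMatrix L (N + L) q).mulVec (fun p => s p.1 p.2 c) d = fracCoeff N q (ext s) c d := by
  unfold Matrix.mulVec dotProduct fracMatrix fracCoeff
  rw [Fintype.sum_prod_type_right]
  refine Finset.sum_congr rfl fun i _ => ?_
  have h1 : ∀ j : Fin (N + L), (if (d : ℕ) ≤ j then (q i).coeff (j - d) else 0) * s j i c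
      = (fun j : ℕ => if (d : ℕ) ≤ j then (q i).coeff (j - d) * ext s j i c else 0) j := by
    intro j
    simp only [ext_of_lt s j.2]
    split_ifs <;> simp
  simp only [h1]
  rw [Fin.sum_univ_eq_sum_range
    (fun j : ℕ => if (d : ℕ) ≤ j then (q i).coeff (j - d) * ext s j i c else 0) (N + L),
    ← Finset.sum_filter]
  have hd := d.2
  have h2 : (Finset.range (N + L)).filter (fun j => (d : ℕ) ≤ j) = Finset.Ico (d : ℕ) (N + L) := by
    ext j
    simp only [Finset.mem_filter, Finset.mem_range, Finset.mem_Ico]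
    tauto
  rw [h2, Finset.sum_Ico_eq_sum_range]
  symm
  refine (Finset.sum_congr rfl fun e _ => ?_).trans (Finset.sum_subset (f := fun e =>
    (q i).coeff (d + e - d) * ext s (d + e) i c)
    (fun e he => Finset.mem_range.2 (by have := Finset.mem_range.1 he; omega)) fun e _ he => ?_)
  · rw [Nat.add_sub_cancel_left, add_comm e]
  · rw [Nat.add_sub_cancel_left, coeff_eq_zero_of_natDegree_lt, zero_mul]
    have := hq i
    simp only [Finset.mem_range] at he
    omega

theorem vecMul_fracMatrix {L l : ℕ} (q : Fin m → F[X]) (a : Fin L → F) (p : Fin l × Fin m) :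
    (fracMatrix L l q).vecMul a p = (toPoly a * q p.2).coeff p.1 := by
  unfold Matrix.vecMul dotProduct fracMatrix toPoly
  rw [Finset.sum_mul, finsetSum_coeff]
  refine Finset.sum_congr rfl fun d _ => ?_
  rw [mul_assoc, coeff_C_mul, mul_comm (X ^ (d : ℕ)), coeff_mul_X_pow']

theorem near_iff_mulVec {N L : ℕ} {q : Fin m → F[X]} (hq : ∀ i, (q i).natDegree ≤ N)
    (s : Fin (N + L) → Fin m → Fin n → F) :
    Near N q L (ext s) ↔
      ∀ c, (fracMatrix L (N + L) q).mulVec (fun p => s p.1 p.2 c) = 0 := by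
  refine forall_congr' fun c => ?_
  rw [funext_iff]
  simp only [fracMatrix_mulVec hq, Pi.zero_apply]
  exact ⟨fun h d => h d d.2, fun h d hd => h ⟨d, hd⟩⟩

section Count

variable [Fintype F]

open Classical in
theorem card_linear_eq (α : Fin m → F) (hα : α ≠ 0) (r : Fin n → F) :
    (Finset.univ.filter fun x : Fin m → Fin n → F => ∀ c, ∑ i, α i * x i c = r c).card
      = Fintype.card F ^ ((m - 1) * n) := by
  obtain ⟨i₀, hi₀⟩ := Function.ne_iff.1 hα
  let f : (Fin m → Fin n → F) →+ (Fin n → F) :=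
    { toFun := fun x c => ∑ i, α i * x i c
      map_zero' := by funext c; simp
      map_add' := fun x y => by funext c; simp [mul_add, Finset.sum_add_distrib] }
  have hsurj : ∀ r, r ∈ Set.range f := by
    intro r
    refine ⟨fun i c => if i = i₀ then (α i₀)⁻¹ * r c else 0, ?_⟩
    funext c
    change ∑ i, α i * (if i = i₀ then (α i₀)⁻¹ * r c else 0) = r c
    simp only [mul_ite, mul_zero, Finset.sum_ite_eq', Finset.mem_univ, if_true]
    rw [← mul_assoc, mul_inv_cancel₀ hi₀, one_mul]
  have h1 : (Finset.univ.filter fun x : Fin m → Fin n → F => ∀ c, ∑ i, α i * x i c = r c)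
      = Finset.univ.filter fun x => f x = r :=
    Finset.filter_congr fun x _ => by rw [funext_iff]; rfl
  rw [h1]
  have h2 := Finset.card_eq_sum_card_fiberwise (f := f) (s := Finset.univ) (t := Finset.univ)
    fun _ _ => Finset.mem_coe.2 (Finset.mem_univ _)
  rw [Finset.sum_congr rfl fun y _ => AddMonoidHom.card_fiber_eq_of_mem_range f (hsurj y) (hsurj r),
    Finset.sum_const] at h2
  simp only [Finset.card_univ, Fintype.card_pi, Finset.prod_const, Fintype.card_fin,
    smul_eq_mul] at h2
  have hm : m = (m - 1) + 1 := by have := i₀.pos; omega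
  have h3 : (Fintype.card F ^ n) ^ m = Fintype.card F ^ n * Fintype.card F ^ ((m - 1) * n) := by
    rw [← pow_mul, ← pow_add]
    congr 1
    conv_lhs => rw [hm]
    ring
  rw [h3] at h2
  exact (Nat.eq_of_mul_eq_mul_left (pow_pos Fintype.card_pos _) h2).symm

open Classical in
/-- A further digit: it has to satisfy one more equation in each column, and this equation is not
trivial because `q` has exact degree `N`. -/
theorem card_update_near {N : ℕ} {q : Fin m → F[X]} (hq : HasDegree N q) {t : ℕ} (ht : N ≤ t)
    (z : ℕ → Fin m → Fin n → F) :
    (Finset.univ.filter fun x => Near N q (t + 1 - N) (Function.update z t x)).card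
      = if Near N q (t - N) z then Fintype.card F ^ ((m - 1) * n) else 0 := by
  have hlow : ∀ x c, ∀ d < t - N,
      fracCoeff N q (Function.update z t x) c d = fracCoeff N q z c d := fun x c d hd =>
    fracCoeff_congr q c fun j hj => Function.update_of_ne (by omega) _ _
  split_ifs with h
  · rw [← card_linear_eq (fun i => (q i).coeff N)
      (by obtain ⟨i, hi⟩ := hq.2; exact Function.ne_iff.2 ⟨i, hi⟩)
      (fun c => -∑ i, ∑ e ∈ Finset.range N, (q i).coeff e * z (e + (t - N)) i c)]
    congr 1
    refine Finset.filter_congr fun x _ => ?_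
    have htop : ∀ c, fracCoeff N q (Function.update z t x) c (t - N)
        = ∑ i, ∑ e ∈ Finset.range N, (q i).coeff e * z (e + (t - N)) i c
          + ∑ i, (q i).coeff N * x i c := by
      intro c
      unfold fracCoeff
      rw [← Finset.sum_add_distrib]
      refine Finset.sum_congr rfl fun i _ => ?_
      rw [Finset.sum_range_succ, show N + (t - N) = t by omega, Function.update_self]
      congr 1
      refine Finset.sum_congr rfl fun e he => ?_
      rw [Function.update_of_ne (by have := Finset.mem_range.1 he; omega)]
    constructor
    · intro hx c
      have := hx c (t - N) (by omega)
      rw [htop] at this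
      exact eq_neg_of_add_eq_zero_right this
    · intro hx c d hd
      rcases Nat.lt_or_ge d (t - N) with hd' | hd'
      · rw [hlow x c d hd']; exact h c d hd'
      · have : d = t - N := by omega
        rw [this, htop, hx c, add_neg_cancel]
  · rw [Finset.card_eq_zero, Finset.filter_eq_empty_iff]
    intro x _ hx
    refine h fun c d hd => ?_
    rw [← hlow x c d hd]
    exact hx c d (by omega)

theorem ext_snoc {S : Type*} [Zero S] {t : ℕ} (s : Fin t → S) (x : S) :
    ext (Fin.snoc (α := fun _ => S) s x) = Function.update (ext s) t x := by
  funext j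
  rcases lt_trichotomy j t with h | h | h
  · rw [Function.update_of_ne h.ne, ext_of_lt _ (by omega), ext_of_lt _ h]
    simp [Fin.snoc, h]
  · subst h
    rw [Function.update_self, ext_of_lt _ (by omega)]
    simp [Fin.snoc]
  · rw [Function.update_of_ne h.ne']
    simp [ext, h.not_gt, show ¬ j < t + 1 by omega]

open Classical in
/-- The number of strings of length `t` that start with `u` and satisfy the equations for
`‖q A‖ < k ^ (N - t)`. -/
noncomputable def fiberCard (N : ℕ) (q : Fin m → F[X]) {l : ℕ} (t : ℕ)
    (u : Fin l → Fin m → Fin n → F) : ℕ :=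
  (Finset.univ.filter fun s : Fin t → Fin m → Fin n → F =>
    pre l (ext s) = u ∧ Near N q (t - N) (ext s)).card

theorem fiberCard_succ {N : ℕ} {q : Fin m → F[X]} (hq : HasDegree N q) {l t : ℕ} (ht : N ≤ t)
    (hl : l ≤ t) (u : Fin l → Fin m → Fin n → F) :
    fiberCard N q (t + 1) u = fiberCard N q t u * Fintype.card F ^ ((m - 1) * n) := by
  classical
  unfold fiberCard
  rw [Finset.card_filter, ← Equiv.sum_comp (Fin.snocEquiv fun _ => Fin m → Fin n → F),
    Fintype.sum_prod_type_right, Finset.card_filter, Finset.sum_mul]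
  refine Finset.sum_congr rfl fun s _ => ?_
  have hpre : ∀ x, pre l (Function.update (ext s) t x) = pre l (ext s) := fun x =>
    pre_eq_iff.2 fun i hi => Function.update_of_ne (by omega) _ _
  have hsnoc : ∀ x, ext ((Fin.snocEquiv fun _ => Fin m → Fin n → F) (x, s))
      = Function.update (ext s) t x := fun x => ext_snoc s x
  simp only [hsnoc, hpre]
  by_cases hu : pre l (ext s) = u
  · simp only [hu, true_and]
    rw [← Finset.card_filter, card_update_near hq ht]
    split_ifs <;> simp
  · simp [hu]

theorem fiberCard_add {N : ℕ} {q : Fin m → F[X]} (hq : HasDegree N q) {l t : ℕ} (ht : N ≤ t)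
    (hl : l ≤ t) (e : ℕ) (u : Fin l → Fin m → Fin n → F) :
    fiberCard N q (t + e) u = fiberCard N q t u * Fintype.card F ^ ((m - 1) * n * e) := by
  induction e with
  | zero => simp
  | succ e ih =>
    rw [← add_assoc, fiberCard_succ hq (by omega) (by omega), ih]
    ring

/-- Down to depth `N` the conditions on the digits are void. -/
theorem fiberCard_of_le {N : ℕ} {q : Fin m → F[X]} (hq : HasDegree N q) {l t : ℕ} (hl : l ≤ N)
    (ht : N ≤ t) (u : Fin l → Fin m → Fin n → F) :
    fiberCard N q t u
      = Fintype.card F ^ (m * n * (N - l)) * Fintype.card F ^ ((m - 1) * n * (t - N)) := by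
  classical
  obtain ⟨e, rfl⟩ := Nat.exists_eq_add_of_le ht
  rw [fiberCard_add hq le_rfl hl, Nat.add_sub_cancel_left]
  congr 1
  obtain ⟨f, rfl⟩ := Nat.exists_eq_add_of_le hl
  unfold fiberCard
  have h : ∀ s : Fin (l + f) → Fin m → Fin n → F, Near (l + f) q (l + f - (l + f)) (ext s) := by
    intro s c d hd
    omega
  refine (congrArg Finset.card (Finset.ext fun s => ?_)).trans
    ((card_ext_pre_eq (J := f) u).trans ?_)
  · simp only [Finset.mem_filter, h s, and_true]
  rw [Nat.add_sub_cancel_left]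
  simp only [Fintype.card_pi, Finset.prod_const, Finset.card_univ, Fintype.card_fin]
  rw [← pow_mul, ← pow_mul]
  congr 1
  ring

open Classical in
theorem fiberCard_of_ge {N : ℕ} {q : Fin m → F[X]} (hq : HasDegree N q) {l t : ℕ} (hl : N ≤ l)
    (ht : l ≤ t) (u : Fin l → Fin m → Fin n → F) :
    fiberCard N q t u
      = if Near N q (l - N) (ext u) then Fintype.card F ^ ((m - 1) * n * (t - l)) else 0 := by
  obtain ⟨e, rfl⟩ := Nat.exists_eq_add_of_le ht
  rw [fiberCard_add hq hl le_rfl, Nat.add_sub_cancel_left]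
  unfold fiberCard
  have h : (Finset.univ.filter fun s : Fin l → Fin m → Fin n → F =>
      pre l (ext s) = u ∧ Near N q (l - N) (ext s))
      = if Near N q (l - N) (ext u) then {u} else ∅ := by
    ext s
    simp only [pre_ext, Finset.mem_filter, Finset.mem_univ, true_and]
    split_ifs with h
    · simp only [Finset.mem_singleton, and_iff_left_iff_imp]
      rintro rfl; exact h
    · simp only [Finset.notMem_empty, iff_false, not_and]
      rintro rfl; exact h
  rw [h]
  split_ifs <;> simp

theorem _root_.Matrix.card_mulVec_eq_zero_mul_pow_rank {ι κ : Type*} [Fintype ι] [Fintype κ]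
    (M : Matrix ι κ F) :
    Nat.card {v : κ → F // M.mulVec v = 0} * Fintype.card F ^ M.rank
      = Fintype.card F ^ Fintype.card κ := by
  have h1 := LinearMap.finrank_range_add_finrank_ker M.mulVecLin
  rw [Module.finrank_fintype_fun_eq_card] at h1
  have h2 : Nat.card {v : κ → F // M.mulVec v = 0} = Nat.card (LinearMap.ker M.mulVecLin) :=
    Nat.card_congr (Equiv.subtypeEquivRight fun v => by simp)
  rw [h2, Module.natCard_eq_pow_finrank (K := F), Nat.card_eq_fintype_card, ← pow_add, ← h1,
    Matrix.rank, add_comm]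

/-- A matrix over a finite field and its transpose have the same rank, in terms of the numbers of
elements of the two kernels. -/
theorem _root_.Matrix.card_mulVec_eq_zero {ι κ : Type*} [Fintype ι] [Fintype κ]
    (M : Matrix ι κ F) :
    Nat.card {v : κ → F // M.mulVec v = 0} * Fintype.card F ^ Fintype.card ι
      = Fintype.card F ^ Fintype.card κ * Nat.card {w : ι → F // M.vecMul w = 0} := by
  have h1 := M.card_mulVec_eq_zero_mul_pow_rank
  have h2 := M.transpose.card_mulVec_eq_zero_mul_pow_rank
  rw [Matrix.rank_transpose] at h2
  simp only [Matrix.mulVec_transpose] at h2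
  have hpos : 0 < Fintype.card F ^ M.rank := pow_pos Fintype.card_pos _
  refine Nat.eq_of_mul_eq_mul_right hpos ?_
  rw [mul_right_comm, h1, mul_assoc, h2]

open Classical in
/-- The number of strings of length `N + L` that are admissible for both `q` and `q'`, through the
relations between `q` and `q'`: the two sets of equations form a matrix whose transpose has the
relations as its kernel. -/
theorem card_near_near {N L : ℕ} {q q' : Fin m → F[X]} (hq : ∀ i, (q i).natDegree ≤ N)
    (hq' : ∀ i, (q' i).natDegree ≤ N) :
    (Finset.univ.filter fun s : Fin (N + L) → Fin m → Fin n → F =>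
        Near N q L (ext s) ∧ Near N q' L (ext s)).card * Fintype.card F ^ (2 * L * n)
      = Fintype.card F ^ (m * n * (N + L)) * relCard L q q' ^ n := by
  set M := Matrix.fromRows (fracMatrix L (N + L) q) (fracMatrix L (N + L) q') with hM
  have h1 := Matrix.card_mulVec_eq_zero M
  have h2 : Nat.card {w : Fin L ⊕ Fin L → F // M.vecMul w = 0} = relCard L q q' := by
    refine Nat.card_congr (Equiv.subtypeEquiv (Equiv.sumArrowEquivProdArrow _ _ _) fun w => ?_)
    have h0 : M.vecMul w = 0 ↔ ∀ p : Fin (N + L) × Fin m,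
        (toPoly (w ∘ Sum.inl) * q p.2 + toPoly (w ∘ Sum.inr) * q' p.2).coeff p.1 = 0 := by
      rw [hM, ← Sum.elim_comp_inl_inr w, Matrix.vecMul_fromRows, funext_iff]
      simp only [Pi.add_apply, vecMul_fracMatrix, Pi.zero_apply, Sum.elim_comp_inl,
        Sum.elim_comp_inr, ← coeff_add]
    rw [h0]
    change _ ↔ ∀ i, toPoly (w ∘ Sum.inl) * q i + toPoly (w ∘ Sum.inr) * q' i = 0
    constructor
    · intro h i
      ext j
      rw [coeff_zero]
      by_cases hj : j < N + L
      · exact h (⟨j, hj⟩, i)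
      · rw [coeff_add, coeff_toPoly_mul_eq_zero _ (hq i) (not_lt.1 hj),
          coeff_toPoly_mul_eq_zero _ (hq' i) (not_lt.1 hj), add_zero]
    · intro h p
      rw [h p.2, coeff_zero]
  have hiff : ∀ s : Fin (N + L) → Fin m → Fin n → F, (Near N q L (ext s) ∧ Near N q' L (ext s)) ↔
      ∀ c, M.mulVec (fun p => s p.1 p.2 c) = 0 := by
    intro s
    rw [near_iff_mulVec hq, near_iff_mulVec hq', ← forall_and]
    refine forall_congr' fun c => ?_
    rw [hM, Matrix.fromRows_mulVec, funext_iff, funext_iff, funext_iff, Sum.forall]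
    rfl
  have h3 : (Finset.univ.filter fun s : Fin (N + L) → Fin m → Fin n → F =>
        Near N q L (ext s) ∧ Near N q' L (ext s)).card
      = Nat.card {v : Fin (N + L) × Fin m → F // M.mulVec v = 0} ^ n := by
    have h4 : Nat.card (Fin n → {v : Fin (N + L) × Fin m → F // M.mulVec v = 0})
        = Nat.card {v : Fin (N + L) × Fin m → F // M.mulVec v = 0} ^ n := by
      rw [Nat.card_fun, Nat.card_eq_fintype_card (α := Fin n), Fintype.card_fin]
    rw [← h4, ← Fintype.card_subtype, ← Nat.card_eq_fintype_card]
    exact Nat.card_congr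
      { toFun := fun s c => ⟨fun p => s.1 p.1 p.2 c, (hiff s.1).1 s.2 c⟩
        invFun := fun f => ⟨fun j i c => (f c).1 (j, i), (hiff _).2 fun c => (f c).2⟩
        left_inv := fun s => rfl
        right_inv := fun f => rfl }
  rw [h2] at h1
  simp only [Fintype.card_sum, Fintype.card_prod, Fintype.card_fin] at h1
  rw [h3, show 2 * L * n = (L + L) * n by ring, pow_mul, ← mul_pow, h1, mul_pow, ← pow_mul]
  congr 2
  ring

theorem one_le_relCard (L : ℕ) (q q' : Fin m → F[X]) : 1 ≤ relCard L q q' := by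
  have : Nonempty {w : (Fin L → F) × (Fin L → F) //
      ∀ i, toPoly w.1 * q i + toPoly w.2 * q' i = 0} := ⟨⟨0, fun i => by simp [toPoly]⟩⟩
  exact Nat.card_pos

theorem relCard_le {L : ℕ} {q q' : Fin m → F[X]} (hq' : q' ≠ 0) :
    relCard L q q' ≤ Fintype.card F ^ L := by
  have : Fintype.card F ^ L = Nat.card (Fin L → F) := by
    rw [Nat.card_fun, Nat.card_eq_fintype_card, Nat.card_eq_fintype_card, Fintype.card_fin]
  rw [this]
  refine Nat.card_le_card_of_injective (fun w => w.1.1) fun w w' h => ?_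
  obtain ⟨⟨a, b⟩, hw⟩ := w
  obtain ⟨⟨a', b'⟩, hw'⟩ := w'
  simp only at h
  subst h
  have := eq_of_relation hq' hw hw'
  subst this
  rfl

open Classical in
/-- For a fixed `q`, few vectors `q'` have nontrivial relations with `q`: if `h q + h' q' = 0`, then
`h'` divides the components of `h q`, and it determines `q'`. -/
theorem sum_relCard_sub_one_le {N L : ℕ} (Q : Finset (Fin m → F[X])) (hQ : ∀ q' ∈ Q, q' ≠ 0)
    {q : Fin m → F[X]} (hq : q ≠ 0) (hqN : ∀ i, (q i).natDegree ≤ N) {T : ℝ}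
    (hT : ∀ f : F[X], f ≠ 0 → f.natDegree ≤ N + L → ({h | h ∣ f}.ncard : ℝ) ≤ T) :
    ∑ q' ∈ Q, ((relCard L q q' : ℝ) - 1) ≤ (Fintype.card F : ℝ) ^ L * T := by
  obtain ⟨i, hi⟩ := Function.ne_iff.1 hq
  simp only [Pi.zero_apply] at hi
  -- all relations with nonzero `h`, sorted by `h`
  set A : (Fin L → F) → Finset ((Fin m → F[X]) × (Fin L → F)) := fun a =>
    (Q ×ˢ Finset.univ).filter fun p => ∀ i, toPoly a * q i + toPoly p.2 * p.1 i = 0 with hA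
  have hT0 : 0 ≤ T := (Nat.cast_nonneg _).trans (hT 1 one_ne_zero (by simp))
  have h1 : ∀ a, a ≠ 0 → ((A a).card : ℝ) ≤ T := by
    intro a ha
    have ha' : toPoly a ≠ 0 := fun h => ha (toPoly_injective (by rw [h]; simp [toPoly]))
    have hne : toPoly a * q i ≠ 0 := mul_ne_zero ha' hi
    have hb : ∀ p ∈ A a, toPoly p.2 ≠ 0 := by
      intro p hp h
      have := (Finset.mem_filter.1 hp).2 i
      rw [h, zero_mul, add_zero] at this
      exact hne this
    refine le_trans ?_ (hT _ hne ?_)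
    · rw [← Set.ncard_coe_finset]
      refine Nat.cast_le.2 (Set.ncard_le_ncard_of_injOn (fun p => toPoly p.2) ?_ ?_
        (finite_dvd hne))
      · intro p hp
        have := (Finset.mem_filter.1 hp).2 i
        exact ⟨-p.1 i, by rw [mul_neg]; exact eq_neg_of_add_eq_zero_left this⟩
      · intro p hp p' hp' h
        have h2 : p.2 = p'.2 := toPoly_injective h
        refine Prod.ext (funext fun i => ?_) h2
        have e1 := (Finset.mem_filter.1 hp).2 i
        have e2 := (Finset.mem_filter.1 hp').2 i
        rw [← h2] at e2
        exact mul_left_cancel₀ (hb p hp) (add_left_cancel (e1.trans e2.symm))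
    · refine natDegree_mul_le.trans ?_
      have hL : (toPoly a).natDegree ≤ L := by
        refine natDegree_le_iff_coeff_eq_zero.2 fun j hj => ?_
        have := coeff_toPoly_mul_eq_zero (N := 0) a (p := 1) (by simp) (j := j) (by omega)
        rwa [mul_one] at this
      have := hqN i
      omega
  have h2 : ∀ q' ∈ Q, (relCard L q q' : ℝ) - 1
      ≤ ∑ a : Fin L → F, if a = 0 then 0 else
        ((Finset.univ.filter fun b : Fin L → F =>
          ∀ i, toPoly a * q i + toPoly b * q' i = 0).card : ℝ) := by
    intro q' hq'
    have e1 : (relCard L q q' : ℝ) = ∑ a : Fin L → F, ((Finset.univ.filter fun b : Fin L → F =>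
          ∀ i, toPoly a * q i + toPoly b * q' i = 0).card : ℝ) := by
      rw [relCard, Nat.card_eq_fintype_card, Fintype.card_subtype, Finset.card_filter,
        Fintype.sum_prod_type]
      push_cast
      refine Finset.sum_congr rfl fun a _ => ?_
      rw [Finset.card_filter]
      push_cast
      rfl
    have e2 : ((Finset.univ.filter fun b : Fin L → F =>
        ∀ i, toPoly (0 : Fin L → F) * q i + toPoly b * q' i = 0).card : ℝ) ≤ 1 := by
      have : (Finset.univ.filter fun b : Fin L → F =>
        ∀ i, toPoly (0 : Fin L → F) * q i + toPoly b * q' i = 0).card ≤ 1 :=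
        Finset.card_le_one.2 fun b hb b' hb' =>
          eq_of_relation (hQ q' hq') (Finset.mem_filter.1 hb).2 (Finset.mem_filter.1 hb').2
      exact_mod_cast this
    rw [e1, ← Finset.add_sum_erase _ _ (Finset.mem_univ (0 : Fin L → F)),
      ← Finset.add_sum_erase (a := (0 : Fin L → F)) _ (fun a => if a = 0 then (0 : ℝ) else _)
        (Finset.mem_univ _), if_pos rfl, zero_add]
    have e3 : ∀ a ∈ Finset.univ.erase (0 : Fin L → F), (if a = 0 then (0 : ℝ) else
        ((Finset.univ.filter fun b : Fin L → F =>
          ∀ i, toPoly a * q i + toPoly b * q' i = 0).card : ℝ))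
        = ((Finset.univ.filter fun b : Fin L → F =>
          ∀ i, toPoly a * q i + toPoly b * q' i = 0).card : ℝ) := fun a ha =>
      if_neg (Finset.ne_of_mem_erase ha)
    rw [Finset.sum_congr rfl e3]
    linarith
  refine (Finset.sum_le_sum h2).trans ?_
  rw [Finset.sum_comm]
  have h3 : ∀ a ∈ (Finset.univ : Finset (Fin L → F)), (∑ q' ∈ Q, if a = 0 then (0 : ℝ) else
        ((Finset.univ.filter fun b : Fin L → F =>
          ∀ i, toPoly a * q i + toPoly b * q' i = 0).card : ℝ)) ≤ T := by
    intro a _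
    by_cases ha : a = 0
    · simpa [ha] using hT0
    · refine le_trans (le_of_eq ?_) (h1 a ha)
      simp only [ha, if_false, hA]
      rw [Finset.card_filter, Finset.sum_product]
      push_cast
      refine Finset.sum_congr rfl fun q' _ => ?_
      rw [Finset.card_filter]
      push_cast
      rfl
  refine (Finset.sum_le_sum h3).trans (le_of_eq ?_)
  rw [Finset.sum_const, nsmul_eq_mul, Finset.card_univ, Fintype.card_fun, Fintype.card_fin]
  push_cast
  rfl

theorem sum_relCard_pow_le {N L : ℕ} (hn : 1 ≤ n) (Q : Finset (Fin m → F[X]))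
    (hQ : ∀ q' ∈ Q, q' ≠ 0)
    {q : Fin m → F[X]} (hq : q ≠ 0) (hqN : ∀ i, (q i).natDegree ≤ N) {T : ℝ}
    (hT : ∀ f : F[X], f ≠ 0 → f.natDegree ≤ N + L → ({h | h ∣ f}.ncard : ℝ) ≤ T) :
    ∑ q' ∈ Q, (relCard L q q' : ℝ) ^ n
      ≤ Q.card + 2 * (Fintype.card F : ℝ) ^ (n * L) * T := by
  set R : ℝ := (Fintype.card F : ℝ) ^ L with hR
  have hR0 : 0 ≤ R := by positivity
  have h1 : ∀ q' ∈ Q, (relCard L q q' : ℝ) ^ n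
      ≤ 1 + 2 * R ^ (n - 1) * ((relCard L q q' : ℝ) - 1) := by
    intro q' hq'
    have hle : (relCard L q q' : ℝ) ≤ R := by
      rw [hR]; exact_mod_cast relCard_le (hQ q' hq')
    rcases (one_le_relCard L q q').eq_or_lt with h | h
    · rw [← h]; simp
    · have h2 : (2 : ℝ) ≤ relCard L q q' := by exact_mod_cast h
      obtain ⟨n', rfl⟩ := Nat.exists_eq_add_of_le hn
      rw [Nat.add_sub_cancel_left, add_comm 1 n', pow_succ]
      have h3 := pow_le_pow_left₀ (by linarith) hle n'
      have h4 : 0 ≤ (relCard L q q' : ℝ) ^ n' := by positivity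
      nlinarith
  refine (Finset.sum_le_sum h1).trans ?_
  rw [Finset.sum_add_distrib, Finset.sum_const, nsmul_eq_mul, mul_one, ← Finset.mul_sum]
  refine add_le_add le_rfl ?_
  refine (mul_le_mul_of_nonneg_left (sum_relCard_sub_one_le Q hQ hq hqN hT)
    (by positivity)).trans (le_of_eq ?_)
  obtain ⟨n', rfl⟩ := Nat.exists_eq_add_of_le hn
  rw [Nat.add_sub_cancel_left, hR]
  ring

end Count

end DigitSeq

/-! ### Energy of the solution sets -/

namespace DigitSeq

variable {F : Type*} [Field F] [Fintype F] {m n : ℕ}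

open Classical in
/-- The pairs of a vector `q ∈ Q` and a string of length `t` that starts with `x` and satisfies the
equations for `‖q A‖ < k ^ (N - t)`. -/
noncomputable def admissible (N t : ℕ) (Q : Finset (Fin m → F[X])) {g : ℕ}
    (x : Fin g → Fin m → Fin n → F) : Finset ((Fin m → F[X]) × (Fin t → Fin m → Fin n → F)) :=
  (Q ×ˢ Finset.univ).filter fun ω => pre g (ext ω.2) = x ∧ Near N ω.1 (t - N) (ext ω.2)

open Classical in
/-- The number of admissible pairs whose string starts with `u`. -/
noncomputable def hits (N t : ℕ) (Q : Finset (Fin m → F[X])) {g : ℕ}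
    (x : Fin g → Fin m → Fin n → F) (l : ℕ) (u : Fin l → Fin m → Fin n → F) : ℕ :=
  ((admissible N t Q x).filter fun ω => pre l (ext ω.2) = u).card

theorem card_admissible {N t g : ℕ} {Q : Finset (Fin m → F[X])} (hQ : ∀ q ∈ Q, HasDegree N q)
    (hg : g ≤ N) (ht : N ≤ t) (x : Fin g → Fin m → Fin n → F) :
    (admissible N t Q x).card = Q.card *
      (Fintype.card F ^ (m * n * (N - g)) * Fintype.card F ^ ((m - 1) * n * (t - N))) := by
  classical
  have h : (admissible N t Q x).card = ∑ q ∈ Q, fiberCard N q t x := by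
    rw [admissible, Finset.card_filter, Finset.sum_product]
    refine Finset.sum_congr rfl fun q _ => ?_
    rw [fiberCard, Finset.card_filter]
  rw [h, Finset.sum_congr rfl fun q hq => fiberCard_of_le (hQ q hq) hg ht x, Finset.sum_const,
    smul_eq_mul]

open Classical in
theorem hits_le {N t g l : ℕ} (Q : Finset (Fin m → F[X])) (x : Fin g → Fin m → Fin n → F)
    (hgl : g ≤ l) (u : Fin l → Fin m → Fin n → F) :
    hits N t Q x l u ≤ if pre g (ext u) = x then ∑ q ∈ Q, fiberCard N q t u else 0 := by
  split_ifs with h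
  · have : ∑ q ∈ Q, fiberCard N q t u = ((Q ×ˢ Finset.univ).filter
        fun ω : (Fin m → F[X]) × (Fin t → Fin m → Fin n → F) =>
          pre l (ext ω.2) = u ∧ Near N ω.1 (t - N) (ext ω.2)).card := by
      rw [Finset.card_filter, Finset.sum_product]
      refine Finset.sum_congr rfl fun q _ => ?_
      rw [fiberCard, Finset.card_filter]
    rw [this]
    refine Finset.card_le_card fun ω hω => ?_
    simp only [admissible, Finset.mem_filter] at hω ⊢
    exact ⟨hω.1.1, hω.2, hω.1.2.2⟩
  · rw [Nat.le_zero, hits, Finset.card_eq_zero, Finset.filter_eq_empty_iff]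
    intro ω hω hu
    simp only [admissible, Finset.mem_filter] at hω
    refine h ?_
    rw [← hω.2.1]
    exact pre_eq_of_le hgl ((pre_ext u).trans hu.symm)

theorem sum_hits {N t g : ℕ} (Q : Finset (Fin m → F[X])) (x : Fin g → Fin m → Fin n → F) (l : ℕ) :
    ∑ u, hits N t Q x l u = (admissible N t Q x).card := by
  classical
  rw [Finset.card_eq_sum_card_fiberwise (f := fun ω => pre l (ext ω.2)) (t := Finset.univ)
    fun _ _ => Finset.mem_coe.2 (Finset.mem_univ _)]
  refine Finset.sum_congr rfl fun u _ => ?_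
  unfold hits
  congr!

theorem sum_hits_sq_le {N t g : ℕ} (Q : Finset (Fin m → F[X])) (x : Fin g → Fin m → Fin n → F)
    (l : ℕ) : ∑ u, hits N t Q x l u ^ 2 ≤ (admissible N t Q x).card ^ 2 := by
  rw [← sum_hits Q x l]
  rw [sq, Finset.sum_mul]
  refine Finset.sum_le_sum fun u hu => ?_
  rw [sq]
  exact Nat.mul_le_mul_left _ (Finset.single_le_sum (fun _ _ => Nat.zero_le _) hu)

/-- Up to depth `N` the admissible strings are equidistributed. -/
theorem sum_hits_sq_mul_le {N t g l : ℕ} {Q : Finset (Fin m → F[X])}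
    (hQ : ∀ q ∈ Q, HasDegree N q) (hgl : g ≤ l) (hl : l ≤ N) (ht : N ≤ t)
    (x : Fin g → Fin m → Fin n → F) :
    (∑ u, hits N t Q x l u ^ 2) * Fintype.card (Fin m → Fin n → F) ^ (l - g)
      ≤ (admissible N t Q x).card ^ 2 := by
  classical
  set P := Q.card *
      (Fintype.card F ^ (m * n * (N - l)) * Fintype.card F ^ ((m - 1) * n * (t - N))) with hP
  have h1 : ∀ u, hits N t Q x l u ^ 2 ≤ if pre g (ext u) = x then P ^ 2 else 0 := by
    intro u
    have h := hits_le (N := N) (t := t) Q x hgl u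
    have h2 : ∑ q ∈ Q, fiberCard N q t u = P := by
      rw [Finset.sum_congr rfl fun q hq => fiberCard_of_le (hQ q hq) hl ht u, Finset.sum_const,
        smul_eq_mul]
    rw [h2] at h
    split_ifs at h ⊢
    · exact Nat.pow_le_pow_left h 2
    · rw [Nat.le_zero.1 h, zero_pow two_ne_zero]
  have h2 : (∑ u, hits N t Q x l u ^ 2)
      ≤ Fintype.card (Fin m → Fin n → F) ^ (l - g) * P ^ 2 := by
    refine (Finset.sum_le_sum fun u _ => h1 u).trans (le_of_eq ?_)
    rw [← Finset.sum_filter, Finset.sum_const, smul_eq_mul]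
    congr 1
    obtain ⟨J, rfl⟩ := Nat.exists_eq_add_of_le hgl
    rw [Nat.add_sub_cancel_left, ← card_ext_pre_eq x]
    congr!
  refine (Nat.mul_le_mul_right _ h2).trans (le_of_eq ?_)
  have h3 : (admissible N t Q x).card = Fintype.card (Fin m → Fin n → F) ^ (l - g) * P := by
    rw [card_admissible hQ (hgl.trans hl) ht, hP]
    have : Fintype.card (Fin m → Fin n → F) = Fintype.card F ^ (m * n) := by
      simp [← pow_mul, mul_comm]
    rw [this, ← pow_mul, show N - g = (l - g) + (N - l) by omega, mul_add, pow_add]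
    ring
  rw [h3]
  ring

/-- Below depth `N` the correlations come from the relations between the vectors in `Q`. -/
theorem sum_hits_sq_mul_le_of_ge {N t g l : ℕ} (hm : 1 ≤ m) (hn : 1 ≤ n)
    {Q : Finset (Fin m → F[X])}
    (hQ : ∀ q ∈ Q, HasDegree N q) (hg : g ≤ N) (hl : N ≤ l) (ht : l ≤ t)
    (x : Fin g → Fin m → Fin n → F) {T : ℝ}
    (hT : ∀ f : F[X], f ≠ 0 → f.natDegree ≤ l → ({h | h ∣ f}.ncard : ℝ) ≤ T) :
    (∑ u, (hits N t Q x l u : ℝ) ^ 2) * (Fintype.card F : ℝ) ^ (m * n * l) * Q.card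
      ≤ ((admissible N t Q x).card : ℝ) ^ 2 * (Fintype.card F : ℝ) ^ (2 * (m * n * g))
        * (Q.card + 2 * (Fintype.card F : ℝ) ^ (n * (l - N)) * T) := by
  classical
  obtain ⟨L, rfl⟩ := Nat.exists_eq_add_of_le hl
  obtain ⟨e, rfl⟩ := Nat.exists_eq_add_of_le ht
  rw [Nat.add_sub_cancel_left]
  have hcard := card_admissible hQ hg (Nat.le_add_right N L |>.trans ht) x
  set k : ℝ := (Fintype.card F : ℝ) with hk
  set a : ℝ := k ^ (m * n * (N - g)) with ha
  set w : ℝ := k ^ (m * n * g) with hw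
  set b : ℝ := k ^ ((m - 1) * n * L) with hb
  set c : ℝ := k ^ ((m - 1) * n * e) with hc
  have hk0 : 0 < k := by rw [hk]; exact_mod_cast Fintype.card_pos
  have e1 : k ^ (m * n * (N + L)) = a * w * b * k ^ (n * L) := by
    rw [ha, hw, hb, ← pow_add, ← pow_add, ← pow_add]
    congr 1
    obtain ⟨m', rfl⟩ := Nat.exists_eq_add_of_le hm
    obtain ⟨f, rfl⟩ := Nat.exists_eq_add_of_le hg
    rw [Nat.add_sub_cancel_left, Nat.add_sub_cancel_left]
    ring
  have e2 : ((admissible N (N + L + e) Q x).card : ℝ) = Q.card * (a * (b * c)) := by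
    rw [hcard]
    push_cast
    rw [ha, hb, hc, show N + L + e - N = L + e by omega, mul_add, pow_add]
  have hne : ∀ q ∈ Q, q ≠ 0 := by
    rintro q hq rfl
    obtain ⟨i, hi⟩ := (hQ 0 hq).2
    exact hi (by simp)
  have h1 : ∀ u : Fin (N + L) → Fin m → Fin n → F, (hits N (N + L + e) Q x (N + L) u : ℝ)
      ≤ ∑ q ∈ Q, if Near N q L (ext u) then c else 0 := by
    intro u
    have h := hits_le (N := N) (t := N + L + e) Q x (hg.trans hl) u
    have h2 : hits N (N + L + e) Q x (N + L) u ≤ ∑ q ∈ Q, fiberCard N q (N + L + e) u := by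
      refine h.trans ?_
      split_ifs
      · exact le_rfl
      · exact Nat.zero_le _
    refine (Nat.cast_le.2 h2).trans (le_of_eq ?_)
    rw [Nat.cast_sum]
    refine Finset.sum_congr rfl fun q hq => ?_
    rw [fiberCard_of_ge (hQ q hq) hl ht u, Nat.add_sub_cancel_left, Nat.add_sub_cancel_left]
    split_ifs
    · push_cast; rfl
    · simp
  have h2 : ∑ u : Fin (N + L) → Fin m → Fin n → F, (hits N (N + L + e) Q x (N + L) u : ℝ) ^ 2
      ≤ c ^ 2 * ∑ q ∈ Q, ∑ q' ∈ Q, ((Finset.univ.filter fun s : Fin (N + L) → Fin m → Fin n → F =>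
        Near N q L (ext s) ∧ Near N q' L (ext s)).card : ℝ) := by
    refine (Finset.sum_le_sum fun u _ => pow_le_pow_left₀ (Nat.cast_nonneg _) (h1 u) 2).trans
      (le_of_eq ?_)
    simp only [sq (∑ q ∈ Q, _), Finset.sum_mul_sum]
    rw [Finset.sum_comm, Finset.mul_sum]
    refine Finset.sum_congr rfl fun q _ => ?_
    rw [Finset.sum_comm, Finset.mul_sum]
    refine Finset.sum_congr rfl fun q' _ => ?_
    rw [Finset.card_filter]
    push_cast
    rw [Finset.mul_sum]
    refine Finset.sum_congr rfl fun u _ => ?_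
    by_cases hA : Near N q L (ext u) <;> by_cases hB : Near N q' L (ext u) <;> simp [hA, hB, sq]
  have h3 : ∀ q ∈ Q, ∀ q' ∈ Q, ((Finset.univ.filter fun s : Fin (N + L) → Fin m → Fin n → F =>
        Near N q L (ext s) ∧ Near N q' L (ext s)).card : ℝ) * k ^ (n * L)
        = a * w * b * (relCard L q q' : ℝ) ^ n := by
    intro q hq q' hq'
    have h := card_near_near (n := n) (L := L) (hQ q hq).1 (hQ q' hq').1
    have h' : ((Finset.univ.filter fun s : Fin (N + L) → Fin m → Fin n → F =>
        Near N q L (ext s) ∧ Near N q' L (ext s)).card : ℝ) * k ^ (2 * L * n)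
        = k ^ (m * n * (N + L)) * (relCard L q q' : ℝ) ^ n := by
      rw [hk]; exact_mod_cast h
    rw [e1] at h'
    have hpos : 0 < k ^ (n * L) := by positivity
    refine mul_right_cancel₀ hpos.ne' ?_
    have e3 : k ^ (2 * L * n) = k ^ (n * L) * k ^ (n * L) := by
      rw [← pow_add]; congr 1; ring
    rw [e3] at h'
    linarith
  have h4 : ∑ q ∈ Q, ∑ q' ∈ Q, (relCard L q q' : ℝ) ^ n
      ≤ Q.card * (Q.card + 2 * k ^ (n * L) * T) := by
    rw [← nsmul_eq_mul, ← Finset.sum_const]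
    exact Finset.sum_le_sum fun q hq => sum_relCard_pow_le hn Q hne (hne q hq) (hQ q hq).1 hT
  have h5 : (∑ q ∈ Q, ∑ q' ∈ Q, ((Finset.univ.filter fun s : Fin (N + L) → Fin m → Fin n → F =>
        Near N q L (ext s) ∧ Near N q' L (ext s)).card : ℝ)) * k ^ (n * L)
        = a * w * b * ∑ q ∈ Q, ∑ q' ∈ Q, (relCard L q q' : ℝ) ^ n := by
    simp only [Finset.sum_mul, Finset.mul_sum]
    exact Finset.sum_congr rfl fun q hq => Finset.sum_congr rfl fun q' hq' => h3 q hq q' hq'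
  have hpos : 0 ≤ c ^ 2 * (a * w * b) * (a * w * b) * Q.card := by positivity
  calc _ ≤ (c ^ 2 * ∑ q ∈ Q, ∑ q' ∈ Q, ((Finset.univ.filter fun s : Fin (N + L) →
          Fin m → Fin n → F => Near N q L (ext s) ∧ Near N q' L (ext s)).card : ℝ))
          * k ^ (m * n * (N + L)) * Q.card := by gcongr
    _ = c ^ 2 * (a * w * b) * Q.card * ((∑ q ∈ Q, ∑ q' ∈ Q, ((Finset.univ.filter
          fun s : Fin (N + L) → Fin m → Fin n → F =>
          Near N q L (ext s) ∧ Near N q' L (ext s)).card : ℝ)) * k ^ (n * L)) := by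
        rw [e1]; ring
    _ = c ^ 2 * (a * w * b) * (a * w * b) * Q.card *
          ∑ q ∈ Q, ∑ q' ∈ Q, (relCard L q q' : ℝ) ^ n := by rw [h5]; ring
    _ ≤ c ^ 2 * (a * w * b) * (a * w * b) * Q.card *
          (Q.card * (Q.card + 2 * k ^ (n * L) * T)) := mul_le_mul_of_nonneg_left h4 hpos
    _ = _ := by rw [e2, mul_comm 2 (m * n * g), pow_mul k (m * n * g), ← hw]; ring

theorem sum_range_one_div_pow_le {θ : ℝ} (hθ : 0 < θ) (hθ1 : θ < 1) (g : ℕ) :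
    ∑ l ∈ Finset.range g, 1 / θ ^ l ≤ 1 / (1 - θ) * (1 / θ ^ g) := by
  have h0 : 0 < 1 - θ := by linarith
  induction g with
  | zero => simp; linarith
  | succ g ih =>
    rw [Finset.sum_range_succ]
    have h1 : 0 < 1 / θ ^ g := by positivity
    have h2 : 1 / θ ^ (g + 1) = 1 / θ ^ g / θ := by rw [pow_succ]; field_simp
    rw [h2]
    have h3 : 1 / (1 - θ) * (1 / θ ^ g) + 1 / θ ^ g
        ≤ 1 / (1 - θ) * (1 / θ ^ g / θ) := by
      rw [show 1 / (1 - θ) * (1 / θ ^ g) + 1 / θ ^ g = (1 / θ ^ g) * ((2 - θ) / (1 - θ)) by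
        field_simp; ring, show 1 / (1 - θ) * (1 / θ ^ g / θ) = (1 / θ ^ g) * (1 / θ / (1 - θ)) by
        field_simp]
      refine mul_le_mul_of_nonneg_left (div_le_div_of_nonneg_right ?_ h0.le) h1.le
      rw [le_div_iff₀ hθ]
      nlinarith [sq_nonneg (1 - θ)]
    linarith

/-- The content of the set of solutions for a family of `q` of degree `N`, in a cylinder whose depth
is small compared with `N`. -/
theorem exists_contentGE_nearSet (hm : 1 ≤ m) (hn : 1 ≤ n) {σ s ε : ℝ} (hε : 0 < ε) (hs0 : 0 ≤ s)
    (hsn : s ≤ n) (hσ : 0 < σ) (hσs : σ = m * n - n + s - 2 * ε) :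
    ∃ B : ℝ, 0 < B ∧ ∀ g : ℕ, ∃ N₀ : ℕ, ∀ N ≥ N₀, ∀ t ≥ N, ∀ Q : Finset (Fin m → F[X]),
      Q.Nonempty → (∀ q ∈ Q, HasDegree N q) →
      (Fintype.card F : ℝ) ^ (s * t - n * N) ≤ Q.card →
      ∀ x, ContentGE ((Fintype.card F : ℝ) ^ (-σ)) (1 / B * ((Fintype.card F : ℝ) ^ (-σ)) ^ g)
        (nearSet (n := n) N Q (t - N) ∩ {w | pre g w = pre g x}) := by
  classical
  set k : ℝ := (Fintype.card F : ℝ) with hk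
  have hk1 : 1 < k := by rw [hk]; exact_mod_cast Fintype.one_lt_card
  have hk0 : 0 < k := by linarith
  set θ : ℝ := k ^ (-σ) with hθdef
  have hθ : 0 < θ := by positivity
  have hθ1 : θ < 1 := Real.rpow_lt_one_of_one_lt_of_neg hk1 (by linarith)
  set κ : ℝ := (Fintype.card (Fin m → Fin n → F) : ℝ) with hκdef
  have hκk : κ = k ^ ((m : ℝ) * n) := by
    rw [hκdef, hk]
    simp only [Fintype.card_pi, Finset.prod_const, Finset.card_univ, Fintype.card_fin]
    push_cast
    rw [← pow_mul, ← Nat.cast_mul, Real.rpow_natCast, mul_comm]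
  have hκθ : 1 < κ * θ := by
    rw [hκk, hθdef, ← Real.rpow_add hk0]
    exact Real.one_lt_rpow hk1 (by linarith)
  have hκ0 : 0 < κ := by rw [hκk]; positivity
  set r : ℝ := 1 / (κ * θ) with hr
  have hr0 : 0 < r := by positivity
  have hr1 : r < 1 := by rw [hr, div_lt_one (by linarith)]; exact hκθ
  obtain ⟨K, hK0, hK⟩ := exists_ncard_dvd_le F hε
  set y : ℝ := k ^ (-ε) with hy
  have hy0 : 0 < y := by positivity
  have hy1 : y < 1 := Real.rpow_lt_one_of_one_lt_of_neg hk1 (by linarith)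
  have h1θ : 0 < 1 - θ := by linarith
  have h1r : 0 < 1 - r := by linarith
  have h1y : 0 < 1 - y := by linarith
  refine ⟨1 / (1 - θ) + 1 / (1 - r) + 1, by positivity, fun g => ?_⟩
  set B := 1 / (1 - θ) + 1 / (1 - r) + 1 with hB
  set A : ℝ := k ^ (2 * (m * n * g)) * (1 + 2 * K) with hA
  have hA0 : 0 < A := by positivity
  obtain ⟨N₁, hN₁⟩ := exists_pow_lt_of_lt_one (show 0 < (1 - y) / A by positivity) hy1
  refine ⟨max N₁ g, fun N hN t ht Q hQne hQ hQcard x => ?_⟩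
  have hNg : g ≤ N := (le_max_right _ _).trans hN
  have hN1 : N₁ ≤ N := (le_max_left _ _).trans hN
  set Ω := admissible N t Q (pre g x) with hΩ
  have hcardQ : (0 : ℝ) < Q.card := by exact_mod_cast hQne.card_pos
  have hΩpos : 0 < Ω.card := by
    rw [hΩ, card_admissible hQ hNg ht]
    have : 0 < Fintype.card F := Fintype.card_pos
    have := hQne.card_pos
    positivity
  -- The energy is a sum over the depths `l`: from `N` on the relations between two vectors matter.
  have hE3 : ∀ l, N ≤ l → l ≤ t → ∑ u, (hits N t Q (pre g x) l u : ℝ) ^ 2 / θ ^ l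
      ≤ (Ω.card : ℝ) ^ 2 * (A * y ^ l) := by
    intro l hl hlt
    rw [← Finset.sum_div]
    have h := sum_hits_sq_mul_le_of_ge (t := t) hm hn hQ hNg hl hlt (pre g x)
      (T := K * k ^ (ε * l)) (by
        intro f hf hfl
        refine (hK f hf).trans (mul_le_mul_of_nonneg_left ?_ hK0.le)
        rw [Nat.card_eq_fintype_card]
        refine Real.rpow_le_rpow_of_exponent_le hk1.le (mul_le_mul_of_nonneg_left ?_ hε.le)
        exact_mod_cast hfl)
    rw [← hk, ← hΩ] at h
    have e1 : k ^ (n * (l - N)) * k ^ (ε * l) ≤ Q.card * k ^ ((n - s + ε) * l) := by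
      refine le_trans ?_ (mul_le_mul_of_nonneg_right hQcard (by positivity))
      rw [← Real.rpow_natCast, ← Real.rpow_add hk0, ← Real.rpow_add hk0]
      refine Real.rpow_le_rpow_of_exponent_le hk1.le ?_
      push_cast [Nat.cast_sub hl]
      have : s * l ≤ s * t := mul_le_mul_of_nonneg_left (by exact_mod_cast hlt) hs0
      linarith
    have e2 : (1 : ℝ) ≤ k ^ ((n - s + ε) * l) :=
      Real.one_le_rpow hk1.le (mul_nonneg (by linarith) (Nat.cast_nonneg _))
    have e3 : (Q.card : ℝ) + 2 * k ^ (n * (l - N)) * (K * k ^ (ε * l))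
        ≤ Q.card * ((1 + 2 * K) * k ^ ((n - s + ε) * l)) := by
      nlinarith
    have e4 : (∑ u, (hits N t Q (pre g x) l u : ℝ) ^ 2) * k ^ (m * n * l)
        ≤ (Ω.card : ℝ) ^ 2 * k ^ (2 * (m * n * g)) * ((1 + 2 * K) * k ^ ((n - s + ε) * l)) := by
      refine le_of_mul_le_mul_right (h.trans ?_) hcardQ
      calc _ ≤ (Ω.card : ℝ) ^ 2 * k ^ (2 * (m * n * g)) *
            (Q.card * ((1 + 2 * K) * k ^ ((n - s + ε) * l))) :=
            mul_le_mul_of_nonneg_left e3 (by positivity)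
        _ = _ := by ring
    have e5 : k ^ ((n - s + ε) * l) = k ^ (m * n * l) * (y ^ l * θ ^ l) := by
      rw [hy, hθdef, ← Real.rpow_natCast, ← Real.rpow_natCast, ← Real.rpow_natCast,
        ← Real.rpow_mul hk0.le, ← Real.rpow_mul hk0.le, ← Real.rpow_add hk0, ← Real.rpow_add hk0]
      congr 1
      push_cast
      rw [hσs]
      ring
    rw [div_le_iff₀ (by positivity)]
    refine le_of_mul_le_mul_right (e4.trans (le_of_eq ?_))
      (show 0 < k ^ (m * n * l) by positivity)
    rw [e5, hA]
    ring
  -- Between the depths `g` and `N` the solutions are equidistributed.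
  have hE2 : ∀ l, g ≤ l → l ≤ N → ∑ u, (hits N t Q (pre g x) l u : ℝ) ^ 2 / θ ^ l
      ≤ (Ω.card : ℝ) ^ 2 * (1 / θ ^ g * r ^ (l - g)) := by
    intro l hgl hl
    rw [← Finset.sum_div]
    have h : (∑ u, (hits N t Q (pre g x) l u : ℝ) ^ 2) * κ ^ (l - g) ≤ (Ω.card : ℝ) ^ 2 := by
      rw [hκdef]
      exact_mod_cast sum_hits_sq_mul_le hQ hgl hl ht (pre g x)
    obtain ⟨j, rfl⟩ := Nat.exists_eq_add_of_le hgl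
    rw [Nat.add_sub_cancel_left] at h ⊢
    rw [div_le_iff₀ (by positivity)]
    refine le_of_mul_le_mul_right (h.trans (le_of_eq ?_)) (show 0 < κ ^ j by positivity)
    rw [hr, div_pow, mul_pow, pow_add, one_pow]
    field_simp
  -- Above depth `g` all solutions lie in one cylinder, and the trivial bound suffices.
  have hE1 : ∀ l, ∑ u, (hits N t Q (pre g x) l u : ℝ) ^ 2 / θ ^ l
      ≤ (Ω.card : ℝ) ^ 2 * (1 / θ ^ l) := by
    intro l
    rw [← Finset.sum_div, mul_one_div]
    refine div_le_div_of_nonneg_right ?_ (by positivity)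
    exact_mod_cast sum_hits_sq_le Q (pre g x) l
  have hconv : 1 / B * θ ^ g = 1 / (B * (1 / θ ^ g)) := by field_simp
  rw [hconv]
  have hθg : 1 ≤ 1 / θ ^ g := by
    rw [le_div_iff₀ (by positivity), one_mul]
    exact pow_le_one₀ hθ.le hθ1.le
  refine contentGE_of_energy hθ hθ1.le hκθ.le Ω (Finset.card_pos.1 hΩpos) (fun ω => ext ω.2)
    (t := t) ?_ (by positivity) ?_
  · intro ω hω w hw
    simp only [hΩ, admissible, Finset.mem_filter, Finset.mem_product] at hω
    have hwe : pre t w = pre t (ext ω.2) := hw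
    refine ⟨⟨ω.1, hω.1.1, hω.2.2.congr (t := t) (by omega) hwe.symm⟩, ?_⟩
    exact (pre_eq_of_le (hNg.trans ht) hwe).trans hω.2.1
  · have hsum : ∑ l ∈ Finset.range (t + 1), ∑ u, (hits N t Q (pre g x) l u : ℝ) ^ 2 / θ ^ l
        ≤ (Ω.card : ℝ) ^ 2 * (B * (1 / θ ^ g)) := by
      rw [← Finset.sum_range_add_sum_Ico _ (show N ≤ t + 1 by omega),
        ← Finset.sum_range_add_sum_Ico _ hNg]
      have s1 : ∑ l ∈ Finset.range g, ∑ u, (hits N t Q (pre g x) l u : ℝ) ^ 2 / θ ^ l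
          ≤ (Ω.card : ℝ) ^ 2 * (1 / (1 - θ) * (1 / θ ^ g)) := by
        refine (Finset.sum_le_sum fun l _ => hE1 l).trans ?_
        rw [← Finset.mul_sum]
        exact mul_le_mul_of_nonneg_left (sum_range_one_div_pow_le hθ hθ1 g) (by positivity)
      have s2 : ∑ l ∈ Finset.Ico g N, ∑ u, (hits N t Q (pre g x) l u : ℝ) ^ 2 / θ ^ l
          ≤ (Ω.card : ℝ) ^ 2 * (1 / (1 - r) * (1 / θ ^ g)) := by
        refine (Finset.sum_le_sum fun l hl =>
          hE2 l (Finset.mem_Ico.1 hl).1 (Finset.mem_Ico.1 hl).2.le).trans ?_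
        rw [← Finset.mul_sum, ← Finset.mul_sum, Finset.sum_Ico_eq_sum_range]
        refine mul_le_mul_of_nonneg_left ?_ (by positivity)
        rw [mul_comm]
        refine mul_le_mul_of_nonneg_right ?_ (by positivity)
        simp only [Nat.add_sub_cancel_left, Finset.range_eq_Ico]
        simpa using geom_sum_Ico_le_of_lt_one (m := 0) (n := N - g) hr0.le hr1
      have s3 : ∑ l ∈ Finset.Ico N (t + 1), ∑ u, (hits N t Q (pre g x) l u : ℝ) ^ 2 / θ ^ l
          ≤ (Ω.card : ℝ) ^ 2 * 1 := by
        refine (Finset.sum_le_sum fun l hl => hE3 l (Finset.mem_Ico.1 hl).1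
          (Nat.lt_succ_iff.1 (Finset.mem_Ico.1 hl).2)).trans ?_
        rw [← Finset.mul_sum, ← Finset.mul_sum]
        refine mul_le_mul_of_nonneg_left ?_ (by positivity)
        have h1 := geom_sum_Ico_le_of_lt_one (m := N) (n := t + 1) hy0.le hy1
        have h2 : y ^ N ≤ (1 - y) / A :=
          (pow_le_pow_of_le_one hy0.le hy1.le hN1).trans hN₁.le
        calc A * ∑ i ∈ Finset.Ico N (t + 1), y ^ i ≤ A * (y ^ N / (1 - y)) :=
              mul_le_mul_of_nonneg_left h1 hA0.le
          _ ≤ A * ((1 - y) / A / (1 - y)) := by gcongr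
          _ = 1 := by field_simp
      have hΩ2 : 0 ≤ (Ω.card : ℝ) ^ 2 := by positivity
      rw [hB]
      nlinarith
    refine le_trans (le_of_eq ?_) (hsum.trans (le_of_eq (mul_comm _ _)))
    unfold hits
    congr!

end DigitSeq

/-! ### Cylinders and Hausdorff dimension -/

namespace DigitSeq

variable {S : Type*} [Zero S] {Y : Type*} [MetricSpace Y]

/-- A set of at least two digit sequences lies in a cylinder whose depth is determined by the
diameter of the corresponding set; a smaller one lies in cylinders of arbitrarily small weight,
which the summand `δ` allows for. -/
theorem exists_node_le {k : ℝ} (hk : 1 < k) {f : (ℕ → S) → Y}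
    (hf : ∀ z w (L : ℕ), dist (f z) (f w) < k ^ (-(L : ℤ)) ↔ pre L z = pre L w)
    {σ : ℝ} (hσ : 0 < σ)
    (t : Set Y) {δ : ℝ≥0∞} (hδ : 0 < δ) :
    ∃ p : Node (S), f ⁻¹' t ⊆ p.cyl ∧
      ENNReal.ofReal ((k ^ (-σ)) ^ p.1)
        ≤ ENNReal.ofReal (k ^ σ) * (⨆ _ : t.Nonempty, Metric.ediam t ^ σ) + δ := by
  classical
  have hk0 : 0 < k := by linarith
  set A := (f ⁻¹' t : Set (ℕ → S)) with hA
  by_cases hsub : ∃ b, ∃ z ∈ A, ∃ w ∈ A, z b ≠ w b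
  · obtain ⟨z, hz, w, hw, hzw⟩ := Nat.find_spec hsub
    set b := Nat.find hsub with hb
    refine ⟨⟨b, pre b z⟩, fun y hy => ?_, ?_⟩
    · refine pre_eq_iff.2 fun i hi => ?_
      have := Nat.find_min hsub hi
      push Not at this
      exact this y hy z hz
    · refine le_trans ?_ le_self_add
      have hne : t.Nonempty := ⟨_, hz⟩
      rw [ciSup_pos hne]
      have hd : k ^ (-((b + 1 : ℕ) : ℤ))
          ≤ dist (f z) (f w) := by
        by_contra h
        exact hzw (pre_eq_iff.1 ((hf z w (b + 1)).1 (not_le.1 h)) b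
          (Nat.lt_succ_self b))
      have hd2 : ENNReal.ofReal (k ^ (-((b + 1 : ℕ) : ℤ))) ≤ Metric.ediam t :=
        (ENNReal.ofReal_le_ofReal hd).trans (by
          rw [← edist_dist]; exact Metric.edist_le_ediam_of_mem hz hw)
      refine le_trans (le_of_eq ?_)
        (mul_le_mul_right (ENNReal.rpow_le_rpow hd2 hσ.le) _)
      rw [ENNReal.ofReal_rpow_of_pos (zpow_pos hk0 _), ← ENNReal.ofReal_mul (by positivity)]
      congr 1
      rw [← Real.rpow_natCast, ← Real.rpow_mul hk0.le, ← Real.rpow_intCast,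
        ← Real.rpow_mul hk0.le, ← Real.rpow_add hk0]
      congr 1
      push_cast
      ring
  · push Not at hsub
    obtain ⟨b, hb⟩ : ∃ b : ℕ, ENNReal.ofReal ((k ^ (-σ)) ^ b) ≤ δ := by
      have h1 : k ^ (-σ) < 1 := Real.rpow_lt_one_of_one_lt_of_neg hk (by linarith)
      have h2 := ENNReal.tendsto_ofReal
        (tendsto_pow_atTop_nhds_zero_of_lt_one (by positivity) h1)
      rw [ENNReal.ofReal_zero] at h2
      obtain ⟨b, hb⟩ := (h2.eventually (gt_mem_nhds hδ)).exists
      exact ⟨b, hb.le⟩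
    by_cases hne : A.Nonempty
    · obtain ⟨z, hz⟩ := hne
      exact ⟨⟨b, pre b z⟩, fun y hy => pre_eq_iff.2 fun i _ => hsub i y hy z hz,
        hb.trans le_add_self⟩
    · refine ⟨⟨b, fun _ => 0⟩, fun y hy => absurd ⟨y, hy⟩ hne, hb.trans le_add_self⟩

/-- A lower bound for the Hausdorff dimension from a lower bound for the weights of
the covers by cylinders. -/
theorem le_dimH_of_cover {k : ℝ} (hk : 1 < k) {f : (ℕ → S) → Y}
    (hf : ∀ z w (L : ℕ), dist (f z) (f w) < k ^ (-(L : ℤ)) ↔ pre L z = pre L w)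
    {σ : ℝ} (hσ : 0 < σ)
    {Z : Set (ℕ → S)}
    (hZ : ∀ p : ℕ → Node (S), Z ⊆ ⋃ i, (p i).cyl →
      1 ≤ ∑' i, ENNReal.ofReal ((k ^ (-σ)) ^ (p i).1))
    {W : Set Y}
    (hW : ∀ z ∈ Z, f z ∈ W) : ENNReal.ofReal σ ≤ dimH W := by
  borelize Y
  by_contra hlt
  have h0 : MeasureTheory.Measure.hausdorffMeasure ((σ.toNNReal : NNReal) : ℝ) W = 0 :=
    hausdorffMeasure_of_dimH_lt (not_le.1 hlt)
  rw [Real.coe_toNNReal σ hσ.le, MeasureTheory.Measure.hausdorffMeasure_apply] at h0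
  simp only [ENNReal.iSup_eq_zero] at h0
  have h1 := h0 1 one_pos
  set c := ENNReal.ofReal (k ^ σ) with hc
  have hk0 : 0 < k := by linarith
  have hc0 : c ≠ 0 := by
    rw [hc, Ne, ENNReal.ofReal_eq_zero, not_le]; positivity
  have hctop : c ≠ ⊤ := ENNReal.ofReal_ne_top
  have h2 : (0 : ℝ≥0∞) < 2⁻¹ / c := ENNReal.div_pos (by simp) hctop
  rw [← h1] at h2
  simp only [iInf_lt_iff] at h2
  obtain ⟨t, ht, -, hsum⟩ := h2
  obtain ⟨δ, hδ, hδsum⟩ := ENNReal.exists_pos_sum_of_countable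
    (show (2⁻¹ : ℝ≥0∞) ≠ 0 by simp) ℕ
  choose p hp hpw using fun i => exists_node_le hk hf hσ (t i) (ENNReal.coe_pos.2 (hδ i))
  have h3 := hZ p fun z hz => by
    obtain ⟨i, hi⟩ := Set.mem_iUnion.1 (ht (hW z hz))
    exact Set.mem_iUnion.2 ⟨i, hp i hi⟩
  have h4 := h3.trans (ENNReal.tsum_le_tsum hpw)
  rw [ENNReal.tsum_add, ENNReal.tsum_mul_left] at h4
  have h5 : c * ∑' i, (⨆ _ : (t i).Nonempty, Metric.ediam (t i) ^ σ) ≤ 2⁻¹ := by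
    refine (mul_le_mul_right hsum.le c).trans ?_
    rw [ENNReal.mul_div_cancel hc0 hctop]
  have h6 := h4.trans_lt (ENNReal.add_lt_add_of_le_of_lt
    (ne_top_of_le_ne_top (by simp) h5) h5 hδsum)
  rw [ENNReal.inv_two_add_inv_two] at h6
  exact lt_irrefl _ h6

end DigitSeq

/-! ### Laurent series and their digits -/

namespace LaurentAtInfty

open DigitSeq

variable {F : Type*} [Field F]

/-- The coefficient of `X⁻ʲ`, as an additive map. -/
noncomputable def cf (j : ℤ) : LaurentAtInfty F →+ F :=
  { toFun := fun f => f.toSeries.coeff j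
    map_zero' := rfl
    map_add' := fun _ _ => rfl }

theorem ext_cf {f g : LaurentAtInfty F} (h : ∀ j, cf j f = cf j g) : f = g :=
  HahnSeries.ext (x := f.toSeries) (y := g.toSeries) (funext h)

theorem norm_lt_zpow_iff [Finite F] (f : LaurentAtInfty F) (L : ℤ) :
    ‖f‖ < (Nat.card F : ℝ) ^ (-L) ↔ ∀ j ≤ L, cf j f = 0 := by
  change absVal f < _ ↔ _
  by_cases hf : f = 0
  · subst hf
    simp only [absVal_zero, map_zero, implies_true, iff_true]
    exact zpow_pos (zero_lt_one.trans one_lt_natCard) _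
  rw [absVal_of_ne hf, zpow_lt_zpow_iff_right₀ one_lt_natCard, neg_lt_neg_iff]
  constructor
  · intro h j hj
    exact HahnSeries.coeff_eq_zero_of_lt_order (hj.trans_lt h)
  · intro h
    by_contra hle
    exact hf (HahnSeries.coeff_order_eq_zero (x := f.toSeries) |>.1 (h _ (not_lt.1 hle)))

theorem ofPoly_C_mul_X_pow (a : F) (e : ℕ) :
    (ofPoly (C a * X ^ e)).toSeries = HahnSeries.single (-(e : ℤ)) a := by
  have h : ofPoly (C a * X ^ e) = (HahnSeries.C a : LaurentSeries F)
      * (HahnSeries.single (-1 : ℤ) (1 : F)) ^ e := by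
    change eval₂ (HahnSeries.C : F →+* LaurentSeries F) _ (C a * X ^ e) = _
    rw [eval₂_mul, eval₂_C, eval₂_X_pow]
  change ofPoly (C a * X ^ e) = _
  rw [h, HahnSeries.single_pow, HahnSeries.C_apply, HahnSeries.single_mul_single]
  simp
  rfl

theorem cf_ofPoly_mul {p : F[X]} {N : ℕ} (hp : p.natDegree ≤ N) (f : LaurentAtInfty F) (j : ℤ) :
    cf j (ofPoly p * f) = ∑ e ∈ Finset.range (N + 1), p.coeff e * cf (j + e) f := by
  conv_lhs => rw [p.as_sum_range_C_mul_X_pow' (Nat.lt_succ_of_le hp)]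
  rw [map_sum, Finset.sum_mul, map_sum]
  refine Finset.sum_congr rfl fun e _ => ?_
  change ((ofPoly (C (p.coeff e) * X ^ e)).toSeries * f.toSeries).coeff j = _
  rw [ofPoly_C_mul_X_pow, HahnSeries.coeff_single_mul, sub_neg_eq_add]
  rfl

theorem cf_one (j : ℤ) : cf j (1 : LaurentAtInfty F) = if j = 0 then 1 else 0 := by
  change (1 : LaurentSeries F).coeff j = _
  rw [HahnSeries.coeff_one]
  congr!

theorem cf_ofPoly (p : F[X]) (j : ℤ) :
    cf j (ofPoly p) = if j ≤ 0 then p.coeff j.natAbs else 0 := by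
  rw [← mul_one (ofPoly p), cf_ofPoly_mul le_rfl]
  simp only [cf_one, mul_ite, mul_one, mul_zero]
  split_ifs with h
  · by_cases hd : j.natAbs ≤ p.natDegree
    · rw [Finset.sum_eq_single j.natAbs]
      · rw [if_pos (by omega)]
      · intro e _ he
        rw [if_neg (by omega)]
      · intro he
        exact absurd (Finset.mem_range.2 (by omega)) he
    · rw [coeff_eq_zero_of_natDegree_lt (not_le.1 hd)]
      refine Finset.sum_eq_zero fun e he => ?_
      rw [if_neg (by have := Finset.mem_range.1 he; omega)]
  · refine Finset.sum_eq_zero fun e he => ?_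
    rw [if_neg (by omega)]

/-- The series `∑_{j ≥ 0} aⱼ X⁻ʲ⁻¹`, of absolute value less than `1`. -/
noncomputable def ofDigits (a : ℕ → F) : LaurentAtInfty F :=
  HahnSeries.ofSuppBddBelow (fun j : ℤ => if 1 ≤ j then a (j - 1).toNat else 0)
    ⟨1, fun j hj => by
      by_contra h
      exact hj (if_neg h)⟩

theorem cf_ofDigits (a : ℕ → F) (j : ℤ) :
    cf j (ofDigits a) = if 1 ≤ j then a (j - 1).toNat else 0 := rfl

theorem cf_ofDigits_succ (a : ℕ → F) (d : ℕ) : cf ((d : ℤ) + 1) (ofDigits a) = a d := by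
  rw [cf_ofDigits, if_pos (by omega)]
  congr 1
  omega

/-- The polynomial part of a Laurent series. -/
theorem exists_polynomial_part (f : LaurentAtInfty F) :
    ∃ p : F[X], ∀ j ≤ 0, cf j (ofPoly p) = cf j f := by
  classical
  refine ⟨∑ e ∈ Finset.range (f.toSeries.order.natAbs + 1), C (cf (-(e : ℤ)) f) * X ^ e,
    fun j hj => ?_⟩
  rw [cf_ofPoly, if_pos hj, finsetSum_coeff]
  simp only [coeff_C_mul_X_pow]
  rw [Finset.sum_ite_eq]
  have hj' : -(j.natAbs : ℤ) = j := by omega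
  split_ifs with h
  · rw [hj']
  · symm
    refine HahnSeries.coeff_eq_zero_of_lt_order ?_
    rw [Finset.mem_range] at h
    omega

theorem eq_ofPoly_add_ofDigits {f : LaurentAtInfty F} {p : F[X]}
    (hp : ∀ j ≤ 0, cf j (ofPoly p) = cf j f) :
    f = ofPoly p + ofDigits fun d => cf ((d : ℤ) + 1) f := by
  refine ext_cf fun j => ?_
  rw [map_add]
  by_cases hj : j ≤ 0
  · rw [hp j hj, cf_ofDigits, if_neg (by omega), add_zero]
  · rw [cf_ofPoly, if_neg hj, zero_add, cf_ofDigits, if_pos (by omega)]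
    congr 2
    omega

section Matrix

variable {m n : ℕ}

/-- The matrix over `F((X⁻¹))`, with entries of absolute value less than `1`, that has a given
sequence of digits. -/
noncomputable def ofDigitsMatrix (z : ℕ → Fin m → Fin n → F) :
    Matrix (Fin m) (Fin n) (LaurentAtInfty F) := fun i c => ofDigits fun j => z j i c

theorem norm_ofDigits_sub_lt_iff [Finite F] (a b : ℕ → F) (L : ℕ) :
    ‖ofDigits a - ofDigits b‖ < (Nat.card F : ℝ) ^ (-(L : ℤ)) ↔ ∀ j < L, a j = b j := by
  rw [norm_lt_zpow_iff]
  simp only [map_sub, sub_eq_zero]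
  constructor
  · intro h j hj
    have := h ((j : ℤ) + 1) (by omega)
    rwa [cf_ofDigits_succ, cf_ofDigits_succ] at this
  · intro h j hj
    by_cases hj1 : 1 ≤ j
    · rw [cf_ofDigits, cf_ofDigits, if_pos hj1, if_pos hj1]
      exact h _ (by omega)
    · rw [cf_ofDigits, cf_ofDigits, if_neg hj1, if_neg hj1]

theorem dist_ofDigitsMatrix_lt_iff [Finite F] (z w : ℕ → Fin m → Fin n → F) (L : ℕ) :
    dist (ofDigitsMatrix z) (ofDigitsMatrix w) < (Nat.card F : ℝ) ^ (-(L : ℤ))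
      ↔ pre L z = pre L w := by
  rw [dist_eq_norm, Matrix.norm_lt_iff (zpow_pos (zero_lt_one.trans one_lt_natCard) _), pre_eq_iff]
  constructor
  · intro h j hj
    funext i c
    exact (norm_ofDigits_sub_lt_iff _ _ L).1 (h i c) j hj
  · intro h i c
    exact (norm_ofDigits_sub_lt_iff _ _ L).2 fun j hj => by rw [h j hj]

theorem cf_vecMul_ofDigitsMatrix {N : ℕ} {q : Fin m → F[X]} (hq : ∀ i, (q i).natDegree ≤ N)
    (z : ℕ → Fin m → Fin n → F) (c : Fin n) (d : ℕ) :
    cf ((d : ℤ) + 1) (Matrix.vecMul (ofPolyVec q) (ofDigitsMatrix z) c) = fracCoeff N q z c d := by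
  change cf ((d : ℤ) + 1) (∑ i, ofPoly (q i) * ofDigits fun j => z j i c) = _
  rw [map_sum]
  refine Finset.sum_congr rfl fun i _ => ?_
  rw [cf_ofPoly_mul (hq i)]
  refine Finset.sum_congr rfl fun e _ => ?_
  rw [show (d : ℤ) + 1 + e = ((e + d : ℕ) : ℤ) + 1 by push_cast; ring, cf_ofDigits_succ]

theorem distToPoly_lt_iff [Finite F] {v : Fin n → LaurentAtInfty F} (L : ℕ) :
    distToPoly v < (Nat.card F : ℝ) ^ (-(L : ℤ)) ↔ ∀ c, ∀ d < L, cf ((d : ℤ) + 1) (v c) = 0 := by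
  have hpos : (0 : ℝ) < (Nat.card F : ℝ) ^ (-(L : ℤ)) :=
    zpow_pos (zero_lt_one.trans one_lt_natCard) _
  rw [distToPoly, Metric.infDist_lt_iff (Set.range_nonempty _)]
  simp only [Set.exists_range_iff, dist_pi_lt_iff hpos]
  constructor
  · rintro ⟨p, hp⟩ c d hd
    have h := hp c
    rw [dist_eq_norm, norm_lt_zpow_iff] at h
    have h1 := h ((d : ℤ) + 1) (by omega)
    rw [map_sub, sub_eq_zero] at h1
    rw [h1]
    change cf ((d : ℤ) + 1) (ofPoly (p c)) = 0
    rw [cf_ofPoly, if_neg (by omega)]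
  · intro h
    choose p hp using fun c => exists_polynomial_part (v c)
    refine ⟨p, fun c => ?_⟩
    rw [dist_eq_norm, norm_lt_zpow_iff]
    intro j hj
    change cf j (v c - ofPoly (p c)) = 0
    rw [map_sub, sub_eq_zero]
    by_cases hj0 : j ≤ 0
    · rw [hp c j hj0]
    · rw [cf_ofPoly, if_neg hj0]
      have := h c (j - 1).toNat (by omega)
      rwa [show (((j - 1).toNat : ℕ) : ℤ) + 1 = j by omega] at this

theorem distToPoly_lt_iff_near [Finite F] {N : ℕ} {q : Fin m → F[X]}
    (hq : ∀ i, (q i).natDegree ≤ N) (z : ℕ → Fin m → Fin n → F) (L : ℕ) :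
    distToPoly (Matrix.vecMul (ofPolyVec q) (ofDigitsMatrix z)) < (Nat.card F : ℝ) ^ (-(L : ℤ))
      ↔ Near N q L z := by
  rw [distToPoly_lt_iff]
  simp only [cf_vecMul_ofDigitsMatrix hq]
  rfl

theorem norm_ofPoly_lt_zpow_iff [Finite F] (p : F[X]) (L : ℕ) :
    ‖ofPoly p‖ < (Nat.card F : ℝ) ^ (L : ℤ) ↔ ∀ j ≥ L, p.coeff j = 0 := by
  have := norm_lt_zpow_iff (ofPoly p) (-(L : ℤ))
  rw [neg_neg] at this
  rw [this]
  constructor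
  · intro h j hj
    have := h (-(j : ℤ)) (by omega)
    rwa [cf_ofPoly, if_pos (by omega), Int.natAbs_neg, Int.natAbs_natCast] at this
  · intro h j hj
    rw [cf_ofPoly, if_pos (by omega)]
    exact h _ (by omega)

theorem norm_ofPolyVec_lt_iff [Finite F] (q : Fin m → F[X]) (L : ℕ) :
    ‖ofPolyVec q‖ < (Nat.card F : ℝ) ^ L ↔ ∀ i, ∀ j ≥ L, (q i).coeff j = 0 := by
  rw [← zpow_natCast, pi_norm_lt_iff (zpow_pos (zero_lt_one.trans one_lt_natCard) _)]
  exact forall_congr' fun i => norm_ofPoly_lt_zpow_iff (q i) L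

theorem norm_ofPolyVec_of_hasDegree [Finite F] {N : ℕ} {q : Fin m → F[X]} (hq : HasDegree N q) :
    ‖ofPolyVec q‖ = (Nat.card F : ℝ) ^ N := by
  obtain ⟨h1, i, hi⟩ := hq
  have hk : (1 : ℝ) < Nat.card F := one_lt_natCard
  have hN : ∀ i, ‖ofPoly (q i)‖ ≤ (Nat.card F : ℝ) ^ N := by
    intro i
    change absVal _ ≤ _
    by_cases h0 : ofPoly (q i) = 0
    · rw [h0, absVal_zero]; positivity
    · have h2 := (norm_ofPoly_lt_zpow_iff (q i) (N + 1)).2 fun j hj =>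
        coeff_eq_zero_of_natDegree_lt (by have := h1 i; omega)
      change absVal _ < _ at h2
      rw [absVal_of_ne h0, zpow_lt_zpow_iff_right₀ hk] at h2
      rw [absVal_of_ne h0, ← zpow_natCast]
      exact zpow_le_zpow_right₀ hk.le (by push_cast at h2; omega)
  refine le_antisymm ((pi_norm_le_iff_of_nonneg (by positivity)).2 hN) ?_
  by_contra h
  exact hi ((norm_ofPolyVec_lt_iff q N).1 (not_le.1 h) i N le_rfl)

theorem exists_hasDegree {q : Fin m → F[X]} (hq : q ≠ 0) : ∃ N, HasDegree N q := by
  classical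
  obtain ⟨i, hi⟩ := Function.ne_iff.1 hq
  obtain ⟨j, hj, hmax⟩ := Finset.exists_max_image
    (Finset.univ.filter fun i => q i ≠ 0) (fun i => (q i).natDegree) ⟨i, by simpa using hi⟩
  refine ⟨(q j).natDegree, fun i => ?_, j, ?_⟩
  · by_cases h : q i = 0
    · simp [h]
    · exact hmax i (by simpa using h)
  · exact leadingCoeff_ne_zero.2 (Finset.mem_filter.1 hj).2

theorem finite_natDegree_le [Finite F] (N : ℕ) :
    {q : Fin m → F[X] | ∀ i, (q i).natDegree ≤ N}.Finite := by
  have : Finite (degreeLT F (N + 1)) := Finite.of_equiv _ (degreeLTEquiv F (N + 1)).symm.toEquiv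
  refine (Set.Finite.pi' fun _ : Fin m =>
    Set.toFinite ((degreeLT F (N + 1) : Submodule F F[X]) : Set F[X])).subset fun q hq i => ?_
  rw [SetLike.mem_coe, mem_degreeLT]
  exact degree_le_natDegree.trans_lt (by exact_mod_cast Nat.lt_succ_of_le (hq i))

end Matrix

end LaurentAtInfty

/-! ### The covering argument -/

namespace DigitSeq

open Filter in
/-- The convergence part of the Borel-Cantelli lemma, for Hausdorff dimension: the set of sequences
that lie in infinitely many of the given unions of cylinders. -/
theorem dimH_image_le_of_summable {S Y : Type*} [MetricSpace Y] {k : ℝ} (hk : 1 < k)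
    {f : (ℕ → S) → Y}
    (hf : ∀ z w (L : ℕ), dist (f z) (f w) < k ^ (-(L : ℤ)) ↔ pre L z = pre L w)
    {τ : ℝ} (hτ : 0 ≤ τ) {Q : Type*} (t : Q → ℕ) (ht : Tendsto t cofinite atTop)
    (U : ∀ q, Finset (Fin (t q) → S))
    (hU : Summable fun q => ((U q).card : ℝ) * k ^ (-(τ * t q)))
    {Z : Set (ℕ → S)} (hZ : ∀ z ∈ Z, {q | pre (t q) z ∈ U q}.Infinite) :
    dimH (f '' Z) ≤ ENNReal.ofReal τ := by
  borelize Y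
  have hk0 : 0 < k := by linarith
  -- only countably many of the sets are nonempty, and these suffice
  have hcount : Countable {q | (U q).Nonempty} := by
    have h := hU.countable_support
    refine (h.mono fun q hq => ?_).to_subtype
    have : 0 < (U q).card := hq.card_pos
    exact (by positivity : ((U q).card : ℝ) * k ^ (-(τ * t q)) ≠ 0)
  set Q' := {q | (U q).Nonempty} with hQ'
  have hdiam : ∀ (q : Q) (u : Fin (t q) → S),
      Metric.ediam (f '' Node.cyl ⟨t q, u⟩) ≤ ENNReal.ofReal (k ^ (-(t q : ℤ))) := by
    intro q u
    refine Metric.ediam_le ?_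
    rintro _ ⟨z, hz, rfl⟩ _ ⟨w, hw, rfl⟩
    rw [edist_dist]
    exact ENNReal.ofReal_le_ofReal ((hf z w (t q)).2 (hz.trans hw.symm)).le
  have hdiamτ : ∀ (q : Q) (u : Fin (t q) → S),
      Metric.ediam (f '' Node.cyl ⟨t q, u⟩) ^ τ ≤ ENNReal.ofReal (k ^ (-(τ * t q))) := by
    intro q u
    refine (ENNReal.rpow_le_rpow (hdiam q u) hτ).trans (le_of_eq ?_)
    rw [ENNReal.ofReal_rpow_of_pos (zpow_pos hk0 _), ← Real.rpow_intCast, ← Real.rpow_mul hk0.le]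
    congr 2
    push_cast
    ring
  have hrow : ∀ q : Q, ∑' u : {u // u ∈ U q}, Metric.ediam (f '' Node.cyl ⟨t q, u.1⟩) ^ τ
      ≤ ENNReal.ofReal (((U q).card : ℝ) * k ^ (-(τ * t q))) := by
    intro q
    rw [tsum_fintype]
    refine (Finset.sum_le_sum fun u _ => hdiamτ q u.1).trans (le_of_eq ?_)
    rw [Finset.sum_const, nsmul_eq_mul, ENNReal.ofReal_mul (Nat.cast_nonneg _),
      ENNReal.ofReal_natCast, Finset.card_univ, Fintype.card_coe]
  have hsumfin : ∑' q : Q', ENNReal.ofReal (((U q).card : ℝ) * k ^ (-(τ * t q))) ≠ ⊤ :=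
    (hU.subtype Q').tsum_ofReal_ne_top
  have hle : MeasureTheory.Measure.hausdorffMeasure τ (f '' Z) ≤ 0 := by
    refine (MeasureTheory.Measure.hausdorffMeasure_le_liminf_tsum
      (ι := fun s : Finset Q' => Σ q : {q : Q' // q ∉ s}, {u // u ∈ U q.1.1}) (l := atTop) τ (f '' Z)
      (fun s : Finset Q' => ⨆ q : {q : Q' // q ∉ s}, ENNReal.ofReal (k ^ (-(t q.1.1 : ℤ)))) ?_
      (fun s i => f '' Node.cyl ⟨t i.1.1.1, i.2.1⟩) ?_ ?_).trans ?_
    · refine ENNReal.tendsto_nhds_zero.2 fun ε hε => ?_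
      obtain ⟨M, hM⟩ : ∃ M : ℕ, ENNReal.ofReal (k⁻¹ ^ M) ≤ ε := by
        have h2 := ENNReal.tendsto_ofReal
          (tendsto_pow_atTop_nhds_zero_of_lt_one (by positivity) (inv_lt_one_of_one_lt₀ hk))
        rw [ENNReal.ofReal_zero] at h2
        obtain ⟨b, hb⟩ := (h2.eventually (gt_mem_nhds hε)).exists
        exact ⟨b, hb.le⟩
      have hfin : {q : Q' | t q.1 < M}.Finite := by
        have h := ht.eventually_ge_atTop M
        rw [eventually_cofinite] at h
        have h' : {q : Q | t q < M}.Finite := h.subset fun q hq => not_le.2 hq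
        exact h'.preimage Subtype.val_injective.injOn
      filter_upwards [eventually_ge_atTop hfin.toFinset] with s hs
      refine iSup_le fun q => (ENNReal.ofReal_le_ofReal ?_).trans hM
      have hq : M ≤ t q.1.1 := by
        by_contra h
        exact q.2 (hs (hfin.mem_toFinset.2 (not_le.1 h)))
      rw [zpow_neg, zpow_natCast, inv_pow]
      exact inv_anti₀ (by positivity) (pow_le_pow_right₀ hk.le hq)
    · refine Eventually.of_forall fun s i => (hdiam _ _).trans ?_
      exact le_iSup (fun q : {q : Q' // q ∉ s} => ENNReal.ofReal (k ^ (-(t q.1.1 : ℤ)))) i.1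
    · refine Eventually.of_forall fun s => ?_
      rintro _ ⟨z, hz, rfl⟩
      obtain ⟨q, hq, hqs⟩ := (hZ z hz).exists_notMem_finset (s.map (Function.Embedding.subtype _))
      have hqQ : q ∈ Q' := ⟨_, hq⟩
      have hqs' : (⟨q, hqQ⟩ : Q') ∉ s := fun h => hqs (Finset.mem_map.2 ⟨⟨q, hqQ⟩, h, rfl⟩)
      exact Set.mem_iUnion.2 ⟨⟨⟨⟨q, hqQ⟩, hqs'⟩, ⟨pre (t q) z, hq⟩⟩, z, rfl, rfl⟩
    · have hterm : ∀ s : Finset Q',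
          (∑' i : Σ q : {q : Q' // q ∉ s}, {u // u ∈ U q.1.1},
            Metric.ediam (f '' Node.cyl ⟨t i.1.1.1, i.2.1⟩) ^ τ)
          ≤ ∑' q : {q : Q' // q ∉ s}, ENNReal.ofReal (((U q.1.1).card : ℝ) *
            k ^ (-(τ * t q.1.1))) := by
        intro s
        rw [ENNReal.tsum_sigma']
        exact ENNReal.tsum_le_tsum fun q => hrow q.1.1
      have hlim := ENNReal.tendsto_tsum_compl_atTop_zero hsumfin
      refine (liminf_le_liminf (Eventually.of_forall hterm)).trans (le_of_eq hlim.liminf_eq)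
  have h0 : MeasureTheory.Measure.hausdorffMeasure ((τ.toNNReal : NNReal) : ℝ) (f '' Z) ≠ ⊤ := by
    rw [Real.coe_toNNReal τ hτ]
    exact ne_top_of_le_ne_top ENNReal.zero_ne_top hle
  exact dimH_le_of_hausdorffMeasure_ne_top h0

end DigitSeq

namespace LaurentAtInfty

open DigitSeq

variable {F : Type*} [Field F] {m n : ℕ}

theorem distToPoly_add_ofPolyVec [Finite F] (v : Fin n → LaurentAtInfty F) (p : Fin n → F[X]) :
    distToPoly (v + ofPolyVec p) = distToPoly v := by
  have hiso : Isometry fun v : Fin n → LaurentAtInfty F => v + ofPolyVec p :=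
    Isometry.of_dist_eq fun a b => dist_add_right a b _
  have hadd : ∀ p p' : Fin n → F[X], ofPolyVec p + ofPolyVec p' = ofPolyVec (p + p') := by
    intro p p'
    funext i
    exact (map_add ofPoly _ _).symm
  have hrange : (fun v : Fin n → LaurentAtInfty F => v + ofPolyVec p) '' Set.range ofPolyVec
      = Set.range ofPolyVec := by
    ext w
    constructor
    · rintro ⟨_, ⟨p', rfl⟩, rfl⟩
      exact ⟨p' + p, (hadd _ _).symm⟩
    · rintro ⟨p', rfl⟩
      exact ⟨_, ⟨p' - p, rfl⟩, (hadd _ _).trans (by rw [sub_add_cancel])⟩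
  have h := Metric.infDist_image hiso (x := v) (t := Set.range ofPolyVec)
  rw [hrange] at h
  exact h

/-- Translation by polynomial matrices reduces the upper bound to matrices with entries of absolute
value less than `1`. -/
theorem dimH_approxSet_le [Finite F] (ψ : (Fin m → F[X]) → ℝ) :
    dimH (approxSet m n ψ)
      ≤ dimH (ofDigitsMatrix '' {z : ℕ → Fin m → Fin n → F | ofDigitsMatrix z ∈ approxSet m n ψ}) := by
  set Z := {z : ℕ → Fin m → Fin n → F | ofDigitsMatrix z ∈ approxSet m n ψ} with hZ
  let τ : (Fin m → Fin n → F[X]) → Matrix (Fin m) (Fin n) (LaurentAtInfty F) →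
    Matrix (Fin m) (Fin n) (LaurentAtInfty F) := fun P A =>
      A + Matrix.of fun i c => ofPoly (P i c)
  have hiso : ∀ P, Isometry (τ P) := fun P => Isometry.of_dist_eq fun a b => dist_add_right a b _
  have hcover : approxSet m n ψ ⊆ ⋃ P, τ P '' (ofDigitsMatrix '' Z) := by
    intro A hA
    choose P hP using fun i c => exists_polynomial_part (A i c)
    set z : ℕ → Fin m → Fin n → F := fun d i c => cf ((d : ℤ) + 1) (A i c) with hz
    have hAz : A = τ P (ofDigitsMatrix z) := by
      funext i c
      exact (eq_ofPoly_add_ofDigits (hP i c)).trans (add_comm _ _)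
    refine Set.mem_iUnion.2 ⟨P, _, ⟨z, ?_, rfl⟩, hAz.symm⟩
    have hq : ∀ q, distToPoly (Matrix.vecMul (ofPolyVec q) A)
        = distToPoly (Matrix.vecMul (ofPolyVec q) (ofDigitsMatrix z)) := by
      intro q
      rw [hAz, show τ P (ofDigitsMatrix z)
        = ofDigitsMatrix z + Matrix.of fun i c => ofPoly (P i c) from rfl, Matrix.vecMul_add]
      have : Matrix.vecMul (ofPolyVec q) (Matrix.of fun i c => ofPoly (P i c))
          = ofPolyVec fun c => ∑ i, q i * P i c := by
        funext c
        change ∑ i, ofPoly (q i) * ofPoly (P i c) = ofPoly (∑ i, q i * P i c)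
        rw [map_sum]
        simp only [map_mul]
      rw [this, distToPoly_add_ofPolyVec]
    change {q | _ < ψ q}.Infinite at hA
    simp only [hq] at hA
    exact hA
  have hcountable : Countable F[X] := by
    have : Countable (ℕ →₀ F) := inferInstance
    exact Countable.of_equiv _ ((Polynomial.toFinsuppIso F).toEquiv.trans
      (AddMonoidAlgebra.coeffEquiv)).symm
  refine (dimH_mono hcover).trans ?_
  rw [dimH_iUnion]
  exact iSup_le fun P => le_of_eq ((hiso P).dimH_image _)

/-- The number of strings of length `t` that are admissible for one vector `q`. -/
theorem card_near_le [Fintype F] (hm : 1 ≤ m) {N t : ℕ} {q : Fin m → F[X]} (hq : HasDegree N q) :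
    letI := Classical.decPred fun s : Fin t → Fin m → Fin n → F => Near N q (t - N) (ext s)
    (Finset.univ.filter fun s : Fin t → Fin m → Fin n → F => Near N q (t - N) (ext s)).card
      ≤ Fintype.card F ^ (n * N + n * (m - 1) * t) := by
  classical
  obtain ⟨m', rfl⟩ := Nat.exists_eq_add_of_le hm
  rcases le_or_gt N t with h | h
  · have h1 := fiberCard_of_le (n := n) (l := 0) hq (Nat.zero_le _) h (fun i => i.elim0)
    refine le_trans (le_of_eq ?_) (h1.trans (by
      obtain ⟨e, rfl⟩ := Nat.exists_eq_add_of_le h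
      rw [← pow_add, Nat.add_sub_cancel_left, Nat.add_sub_cancel_left, Nat.sub_zero]
      congr 1
      ring)).le
    unfold fiberCard
    congr 1
    ext s
    simp only [Finset.mem_filter, Finset.mem_univ, true_and, iff_and_self]
    intro _
    funext i
    exact i.elim0
  · refine (Finset.card_filter_le _ _).trans ?_
    simp only [Finset.card_univ, Fintype.card_pi, Finset.prod_const, Fintype.card_fin]
    rw [← pow_mul, ← pow_mul, Nat.add_sub_cancel_left]
    refine Nat.pow_le_pow_right Fintype.card_pos ?_
    have : n * t ≤ n * N := Nat.mul_le_mul_left _ h.le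
    calc n * ((1 + m') * t) = n * t + n * m' * t := by ring
      _ ≤ _ := Nat.add_le_add_right this _

end LaurentAtInfty

/-! ### The dimension of the set of well approximable matrices -/

namespace LaurentAtInfty

open DigitSeq

variable {F : Type*} [Field F] {m n : ℕ}

theorem exists_hasDegree_gt {c : ℕ} {q : Fin m → F[X]} (hq : ¬ ∀ i, (q i).natDegree ≤ c) :
    ∃ N, HasDegree N q ∧ c < N := by
  obtain ⟨N, hN⟩ := exists_hasDegree (q := q) (by rintro rfl; exact hq fun i => by simp)
  refine ⟨N, hN, ?_⟩
  by_contra h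
  exact hq fun i => (hN.1 i).trans (not_lt.1 h)

theorem psi_nonneg {ψ : (Fin m → F[X]) → ℝ}
    (hψ : ∀ q, ψ q = 0 ∨ ∃ r : ℤ, ψ q = (Nat.card F : ℝ) ^ r) (q : Fin m → F[X]) : 0 ≤ ψ q := by
  rcases hψ q with h | ⟨r, h⟩ <;> rw [h]
  positivity

variable [Finite F]

theorem term_eq {ψ : (Fin m → F[X]) → ℝ} {N t : ℕ} {q : Fin m → F[X]} (hq : HasDegree N q)
    (hψ : ψ q = (Nat.card F : ℝ) ^ ((N : ℤ) - t)) (η : ℝ) :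
    ‖ofPolyVec q‖ ^ n * (ψ q / ‖ofPolyVec q‖) ^ η = (Nat.card F : ℝ) ^ (n * N - η * t : ℝ) := by
  have hk0 : (0 : ℝ) < Nat.card F := zero_lt_one.trans one_lt_natCard
  rw [norm_ofPolyVec_of_hasDegree hq, hψ, zpow_sub₀ hk0.ne', zpow_natCast, zpow_natCast,
    div_div_cancel_left' (by positivity), ← Real.rpow_natCast, ← Real.rpow_natCast,
    ← Real.rpow_natCast, ← Real.rpow_neg hk0.le, ← Real.rpow_mul hk0.le, ← Real.rpow_mul hk0.le,
    ← Real.rpow_add hk0]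
  congr 1
  ring

theorem term_nonneg {ψ : (Fin m → F[X]) → ℝ} (hψ : ∀ q, 0 ≤ ψ q) (η : ℝ) (q : Fin m → F[X]) :
    0 ≤ ‖ofPolyVec q‖ ^ n * (ψ q / ‖ofPolyVec q‖) ^ η := by
  have := hψ q
  positivity

/-- Outside a finite set of `q`, `ψ(q) / |q| = k⁻ᵗ` with a natural number `t`. -/
theorem exists_depth {ψ : (Fin m → F[X]) → ℝ}
    (hψ : ∀ q, ψ q = 0 ∨ ∃ r : ℤ, ψ q = (Nat.card F : ℝ) ^ r) {c : ℕ}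
    (hc : ∀ q, ψ q ≤ (Nat.card F : ℝ) ^ c) {q : Fin m → F[X]} (hq : ¬ ∀ i, (q i).natDegree ≤ c)
    (h0 : ψ q ≠ 0) :
    ∃ N t : ℕ, HasDegree N q ∧ ψ q = (Nat.card F : ℝ) ^ ((N : ℤ) - t) ∧ N ≤ t + c := by
  obtain ⟨N, hN, hcN⟩ := exists_hasDegree_gt hq
  obtain ⟨r, hr⟩ := (hψ q).resolve_left h0
  have h := hc q
  rw [hr, ← zpow_natCast, zpow_le_zpow_iff_right₀ one_lt_natCard] at h
  exact ⟨N, (N - r).toNat, hN, by rw [hr]; congr 1; omega, by omega⟩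

theorem exists_bound_pow {ψ : (Fin m → F[X]) → ℝ} (h : ∃ C : ℝ, ∀ q, ψ q ≤ C) :
    ∃ c : ℕ, ∀ q, ψ q ≤ (Nat.card F : ℝ) ^ c := by
  obtain ⟨C, hC⟩ := h
  obtain ⟨c, hc⟩ := pow_unbounded_of_one_lt C (one_lt_natCard (F := F))
  exact ⟨c, fun q => (hC q).trans hc.le⟩

/-- The series can only converge for positive exponents. -/
theorem pos_of_summable {ψ : (Fin m → F[X]) → ℝ}
    (hψ : ∀ q, ψ q = 0 ∨ ∃ r : ℤ, ψ q = (Nat.card F : ℝ) ^ r) {c : ℕ}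
    (hc : ∀ q, ψ q ≤ (Nat.card F : ℝ) ^ c) (hpos : {q | 0 < ψ q}.Infinite) {η : ℝ}
    (hη : Summable fun q : Fin m → F[X] => ‖ofPolyVec q‖ ^ n * (ψ q / ‖ofPolyVec q‖) ^ η) :
    0 < η := by
  by_contra hle
  have hk : (1 : ℝ) < Nat.card F := one_lt_natCard
  have h := hη.tendsto_cofinite_zero.eventually (gt_mem_nhds (zero_lt_one))
  rw [Filter.eventually_cofinite] at h
  refine (hpos.sdiff (finite_natDegree_le c)) (h.subset fun q hq => ?_)
  obtain ⟨N, t, hN, ht, -⟩ := exists_depth hψ hc hq.2 hq.1.ne'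
  refine not_lt.2 ?_
  rw [term_eq hN ht]
  refine Real.one_le_rpow hk.le ?_
  have : η * t ≤ 0 := mul_nonpos_of_nonpos_of_nonneg (not_lt.1 hle) (Nat.cast_nonneg _)
  have : (0 : ℝ) ≤ n * N := by positivity
  linarith

open Filter in
/-- The upper bound: almost all `q` with `ψ(q) ≠ 0` have `ψ(q) / |q| = k⁻ᵗ`, and the solutions for
such a `q` are covered by `k ^ (n N + n (m - 1) t)` cylinders of depth `t`. -/
theorem dimH_approxSet_le_of_summable (hm : 1 ≤ m) {ψ : (Fin m → F[X]) → ℝ}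
    (hψ : ∀ q, ψ q = 0 ∨ ∃ r : ℤ, ψ q = (Nat.card F : ℝ) ^ r) {c : ℕ}
    (hc : ∀ q, ψ q ≤ (Nat.card F : ℝ) ^ c) {η : ℝ} (hη0 : 0 ≤ η)
    (hη : Summable fun q : Fin m → F[X] => ‖ofPolyVec q‖ ^ n * (ψ q / ‖ofPolyVec q‖) ^ η) :
    dimH (approxSet m n ψ) ≤ ENNReal.ofReal (n * (m - 1) + η) := by
  classical
  have : Fintype F := Fintype.ofFinite F
  have hk : (1 : ℝ) < Nat.card F := one_lt_natCard
  have hk0 : (0 : ℝ) < Nat.card F := by linarith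
  have hm1 : (1 : ℝ) ≤ m := by exact_mod_cast hm
  refine (dimH_approxSet_le ψ).trans ?_
  let Q := {q : Fin m → F[X] // ψ q ≠ 0 ∧ ¬ ∀ i, (q i).natDegree ≤ c}
  choose N t hN ht hNt using fun q : Q => exists_depth hψ hc q.2.2 q.2.1
  refine dimH_image_le_of_summable hk dist_ofDigitsMatrix_lt_iff
    (add_nonneg (mul_nonneg (Nat.cast_nonneg _) (by linarith)) hη0) t ?_
    (fun q => Finset.univ.filter fun s => Near (N q) q.1 (t q - N q) (ext s)) ?_ ?_
  · rw [tendsto_atTop]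
    intro M
    rw [eventually_cofinite]
    refine ((finite_natDegree_le (F := F) (m := m) (M + c)).preimage
      Subtype.val_injective.injOn).subset fun q hq i => ?_
    have h1 := (hN q).1 i
    have h2 := hNt q
    have h3 : t q < M := not_le.1 hq
    exact h1.trans (by omega)
  · refine Summable.of_nonneg_of_le (fun q => by positivity) (fun q => ?_)
      (hη.comp_injective (Subtype.val_injective (p := fun q => ψ q ≠ 0 ∧ _)))
    simp only [Function.comp_apply]
    rw [term_eq (hN q) (ht q)]
    have h1 : ((Finset.univ.filter fun s : Fin (t q) → Fin m → Fin n → F =>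
        Near (N q) q.1 (t q - N q) (ext s)).card : ℝ)
        ≤ (Nat.card F : ℝ) ^ (n * N q + n * (m - 1) * t q) := by
      rw [Nat.card_eq_fintype_card]
      refine le_trans (le_of_eq ?_) (Nat.cast_le.2 (card_near_le hm (hN q)) |>.trans
        (by push_cast; exact le_rfl))
      congr!
    refine (mul_le_mul_of_nonneg_right h1 (by positivity)).trans (le_of_eq ?_)
    rw [← Real.rpow_natCast, ← Real.rpow_add hk0]
    congr 1
    push_cast [Nat.cast_sub hm]
    ring
  · intro z hz
    refine Set.Infinite.of_image (Subtype.val : Q → _) ?_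
    refine (Set.Infinite.sdiff hz (finite_natDegree_le c)).mono fun q hq => ?_
    obtain ⟨hq1, hq2⟩ := hq
    have hpos : 0 < ψ q := lt_of_le_of_lt Metric.infDist_nonneg hq1
    refine ⟨⟨q, hpos.ne', hq2⟩, ?_, rfl⟩
    set x : Q := ⟨q, hpos.ne', hq2⟩ with hx
    refine Finset.mem_filter.2 ⟨Finset.mem_univ _, ?_⟩
    rcases le_or_gt (N x) (t x) with h | h
    · have h2 : Near (N x) q (t x - N x) z := by
        rw [← distToPoly_lt_iff_near (hN x).1 z]
        refine lt_of_lt_of_le hq1 (le_of_eq ((ht x).trans ?_))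
        congr 1
        omega
      exact h2.congr (t := t x) (by omega) (pre_ext _).symm
    · intro j d hd
      omega

theorem dimH_approxSet_le_mul (ψ : (Fin m → F[X]) → ℝ) :
    dimH (approxSet m n ψ) ≤ ENNReal.ofReal (m * n) := by
  classical
  have : Fintype F := Fintype.ofFinite F
  have hk : (1 : ℝ) < Nat.card F := one_lt_natCard
  have hk0 : (0 : ℝ) < Nat.card F := by linarith
  refine (dimH_approxSet_le ψ).trans (ENNReal.le_of_forall_pos_le_add fun δ hδ _ => ?_)
  have hδ' : (0 : ℝ) < δ := hδ
  rw [← ENNReal.ofReal_coe_nnreal, ← ENNReal.ofReal_add (by positivity) hδ'.le]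
  refine dimH_image_le_of_summable hk dist_ofDigitsMatrix_lt_iff (by positivity) (fun b : ℕ => b)
    (by rw [Nat.cofinite_eq_atTop]; exact Filter.tendsto_id) (fun b => Finset.univ) ?_ ?_
  · have h1 : (Nat.card F : ℝ) ^ (-(δ : ℝ)) < 1 :=
      Real.rpow_lt_one_of_one_lt_of_neg hk (by linarith)
    refine (summable_geometric_of_lt_one (by positivity) h1).congr fun b => ?_
    simp only [Finset.card_univ, Fintype.card_pi, Finset.prod_const, Fintype.card_fin]
    rw [Nat.card_eq_fintype_card] at *
    push_cast
    rw [← Real.rpow_natCast, ← Real.rpow_natCast, ← Real.rpow_natCast, ← Real.rpow_natCast,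
      ← Real.rpow_mul hk0.le, ← Real.rpow_mul hk0.le, ← Real.rpow_mul hk0.le,
      ← Real.rpow_add hk0]
    congr 1
    ring
  · intro z _
    simpa using Set.infinite_univ

/-- For infinitely many degrees `N` there are at least `k ^ (s t - n N)` vectors `q` of degree `N`
with `ψ(q) ≥ |q| k⁻ᵗ`. -/
def HasManyVectors (n : ℕ) (ψ : (Fin m → F[X]) → ℝ) (s : ℝ) : Prop :=
  ∀ N₀ : ℕ, ∃ N ≥ N₀, ∃ t ≥ N, ∃ Q : Finset (Fin m → F[X]), Q.Nonempty ∧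
    (∀ q ∈ Q, HasDegree N q ∧ (Nat.card F : ℝ) ^ ((N : ℤ) - t) ≤ ψ q) ∧
    (Nat.card F : ℝ) ^ (s * t - n * N) ≤ Q.card

theorem hasManyVectors_zero {ψ : (Fin m → F[X]) → ℝ}
    (hψ : ∀ q, ψ q = 0 ∨ ∃ r : ℤ, ψ q = (Nat.card F : ℝ) ^ r) (hpos : {q | 0 < ψ q}.Infinite) :
    HasManyVectors n ψ 0 := by
  intro N₀
  have hk : (1 : ℝ) < Nat.card F := one_lt_natCard
  obtain ⟨q, hq, hqN⟩ := (hpos.sdiff (finite_natDegree_le N₀)).nonempty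
  obtain ⟨N, hN, hlt⟩ := exists_hasDegree_gt hqN
  obtain ⟨r, hr⟩ := (hψ q).resolve_left (ne_of_gt hq)
  refine ⟨N, hlt.le, (max (N : ℤ) (N - r)).toNat, by omega, {q}, Finset.singleton_nonempty q,
    ?_, ?_⟩
  · intro q' hq'
    rw [Finset.mem_singleton.1 hq', hr]
    exact ⟨hN, zpow_le_zpow_right₀ hk.le (by omega)⟩
  · rw [Finset.card_singleton, Nat.cast_one]
    refine Real.rpow_le_one_of_one_le_of_nonpos hk.le ?_
    have : (0 : ℝ) ≤ n * N := by positivity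
    linarith

/-- Divergence of the series with exponent `s'` produces, by the pigeonhole principle, pairs
`(N, t)` that many `q` share: otherwise the sum would be dominated by
`∑_{t ≥ N} k ^ (-(s' - s) t)`. -/
theorem hasManyVectors_of_not_summable {ψ : (Fin m → F[X]) → ℝ}
    (hψ : ∀ q, ψ q = 0 ∨ ∃ r : ℤ, ψ q = (Nat.card F : ℝ) ^ r) {s s' : ℝ} (hs0 : 0 ≤ s)
    (hsn : s ≤ n) (hss' : s < s')
    (hdiv : ¬ Summable fun q : Fin m → F[X] =>
      ‖ofPolyVec q‖ ^ n * (ψ q / ‖ofPolyVec q‖) ^ s') :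
    HasManyVectors n ψ s := by
  classical
  intro N₀
  by_contra hcon
  push Not at hcon
  refine hdiv ?_
  have hk : (1 : ℝ) < Nat.card F := one_lt_natCard
  have hk0 : (0 : ℝ) < Nat.card F := by linarith
  have hψ0 := psi_nonneg hψ
  set E := (finite_natDegree_le (F := F) (m := m) N₀).toFinset with hE
  have hdata : ∀ x : {q : Fin m → F[X] // q ∉ E}, ∃ N t : ℕ, N₀ ≤ N ∧ N ≤ t ∧ HasDegree N x.1 ∧
      (ψ x.1 = 0 ∨ ψ x.1 = (Nat.card F : ℝ) ^ ((N : ℤ) - t)) := by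
    rintro ⟨q, hq⟩
    rw [hE, Set.Finite.mem_toFinset] at hq
    obtain ⟨N, hN, hlt⟩ := exists_hasDegree_gt hq
    rcases hψ q with h | ⟨r, hr⟩
    · exact ⟨N, N, hlt.le, le_rfl, hN, Or.inl h⟩
    · have hr0 : r ≤ 0 := by
        by_contra hr0
        have h1 := hcon N hlt.le N le_rfl {q} (Finset.singleton_nonempty q) (by
          intro q' hq'
          rw [Finset.mem_singleton.1 hq', hr]
          exact ⟨hN, zpow_le_zpow_right₀ hk.le (by omega)⟩)
        rw [Finset.card_singleton, Nat.cast_one] at h1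
        refine absurd (Real.rpow_le_one_of_one_le_of_nonpos hk.le ?_) (not_le.2 h1)
        have : s * N ≤ n * N := mul_le_mul_of_nonneg_right hsn (Nat.cast_nonneg _)
        linarith
      exact ⟨N, (N - r).toNat, hlt.le, by omega, hN, Or.inr (by rw [hr]; congr 1; omega)⟩
  choose N t hN₀ hNt hN hval using hdata
  rw [← E.summable_compl_iff]
  set g : {q : Fin m → F[X] // q ∉ E} → ℝ :=
    fun x => ‖ofPolyVec x.1‖ ^ n * (ψ x.1 / ‖ofPolyVec x.1‖) ^ s' with hg
  have hs' : s' ≠ 0 := (hs0.trans_lt hss').ne'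
  have hg0 : ∀ x, ψ x.1 = 0 → g x = 0 := by
    intro x hx
    simp only [hg]
    rw [hx, zero_div, Real.zero_rpow hs', mul_zero]
  set w : ℝ := (Nat.card F : ℝ) ^ (-((s' - s) / 2)) with hw
  have hw0 : 0 < w := by positivity
  have hw1 : w < 1 := Real.rpow_lt_one_of_one_lt_of_neg hk (by linarith)
  have hsumw : Summable fun p : ℕ × ℕ => w ^ p.1 * w ^ p.2 :=
    (summable_geometric_of_lt_one hw0.le hw1).mul_of_nonneg
      (summable_geometric_of_lt_one hw0.le hw1) (fun _ => by positivity) fun _ => by positivity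
  refine summable_of_sum_le (c := ∑' p : ℕ × ℕ, w ^ p.1 * w ^ p.2)
    (fun x => term_nonneg hψ0 s' x.1) fun u => ?_
  rw [← Finset.sum_fiberwise_of_maps_to (g := fun x => (N x, t x))
    (t := u.image fun x => (N x, t x)) fun x hx => Finset.mem_image_of_mem _ hx]
  refine (Finset.sum_le_sum fun p hp => ?_).trans
    (hsumw.sum_le_tsum (u.image fun x => (N x, t x)) fun _ _ => by positivity)
  obtain ⟨x₀, -, rfl⟩ := Finset.mem_image.1 hp
  set V := (u.filter fun x => (N x, t x) = (N x₀, t x₀)).filter fun x => ψ x.1 ≠ 0 with hV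
  have h1 : ∑ x ∈ u with (N x, t x) = (N x₀, t x₀), g x
      = ∑ x ∈ V, (Nat.card F : ℝ) ^ (n * N x₀ - s' * t x₀ : ℝ) := by
    rw [← Finset.sum_filter_add_sum_filter_not _ (fun x => ψ x.1 ≠ 0)]
    rw [Finset.sum_eq_zero (s := Finset.filter (fun x => ¬ ψ x.1 ≠ 0) _)
      (fun x hx => hg0 x (not_not.1 (Finset.mem_filter.1 hx).2)), add_zero]
    refine Finset.sum_congr rfl fun x hx => ?_
    obtain ⟨hx12, hx3⟩ := Finset.mem_filter.1 hx
    obtain ⟨hx1, hx2⟩ := Prod.mk.inj (Finset.mem_filter.1 hx12).2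
    rw [← hx1, ← hx2]
    exact term_eq (hN x) ((hval x).resolve_left hx3) s'
  rw [h1, Finset.sum_const, nsmul_eq_mul]
  have hNt0 : (N x₀ : ℝ) ≤ t x₀ := by exact_mod_cast hNt x₀
  have h3 : (Nat.card F : ℝ) ^ (s * t x₀ - n * N x₀ : ℝ)
      * (Nat.card F : ℝ) ^ (n * N x₀ - s' * t x₀ : ℝ) ≤ w ^ N x₀ * w ^ t x₀ := by
    rw [hw, ← Real.rpow_natCast, ← Real.rpow_natCast, ← Real.rpow_mul hk0.le,
      ← Real.rpow_mul hk0.le, ← Real.rpow_add hk0, ← Real.rpow_add hk0]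
    refine Real.rpow_le_rpow_of_exponent_le hk.le ?_
    nlinarith
  rcases V.eq_empty_or_nonempty with hVe | hVn
  · rw [hVe, Finset.card_empty, Nat.cast_zero, zero_mul]
    positivity
  · have h2 := hcon (N x₀) (hN₀ x₀) (t x₀) (hNt x₀) (V.map (Function.Embedding.subtype _))
      (hVn.map) (by
        intro q hq
        obtain ⟨x, hx, rfl⟩ := Finset.mem_map.1 hq
        simp only [hV, Finset.mem_filter, Prod.mk.injEq] at hx
        obtain ⟨⟨-, hx1, hx2⟩, hx3⟩ := hx
        rw [← hx1, ← hx2]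
        exact ⟨hN x, ((hval x).resolve_left hx3).ge⟩)
    rw [Finset.card_map] at h2
    exact (mul_le_mul_of_nonneg_right h2.le (by positivity)).trans h3

/-- The lower bound: for each `j`, the matrices `A` with `‖q A‖ < ψ(q)` for some `q` of degree at
least `j` have full net content, and so has the intersection over `j`. -/
theorem le_dimH_approxSet (hm : 1 ≤ m) (hn : 1 ≤ n) {ψ : (Fin m → F[X]) → ℝ} {σ s ε : ℝ}
    (hε : 0 < ε) (hs0 : 0 ≤ s) (hsn : s ≤ n) (hσ : 0 < σ) (hσs : σ = m * n - n + s - 2 * ε)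
    (hψ : HasManyVectors n ψ s) : ENNReal.ofReal σ ≤ dimH (approxSet m n ψ) := by
  have : Fintype F := Fintype.ofFinite F
  have hk : (1 : ℝ) < Nat.card F := one_lt_natCard
  have hk0 : (0 : ℝ) < Nat.card F := by linarith
  obtain ⟨B, hB, hcont⟩ := exists_contentGE_nearSet (F := F) hm hn hε hs0 hsn hσ hσs
  rw [← Nat.card_eq_fintype_card] at hcont
  set θ : ℝ := (Nat.card F : ℝ) ^ (-σ) with hθdef
  have hθ : 0 < θ := by positivity
  have hθ1 : θ < 1 := Real.rpow_lt_one_of_one_lt_of_neg hk (by linarith)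
  have hκθ : 1 < (Fintype.card (Fin m → Fin n → F) : ℝ) * θ := by
    have : (Fintype.card (Fin m → Fin n → F) : ℝ) = (Nat.card F : ℝ) ^ ((m : ℝ) * n) := by
      simp only [Fintype.card_pi, Finset.prod_const, Finset.card_univ, Fintype.card_fin]
      rw [Nat.card_eq_fintype_card]
      push_cast
      rw [← pow_mul, ← Nat.cast_mul, Real.rpow_natCast, mul_comm]
    rw [this, hθdef, ← Real.rpow_add hk0]
    exact Real.one_lt_rpow hk (by linarith)
  obtain ⟨J, hJ⟩ := pow_unbounded_of_one_lt B hκθ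
  have hJ' : 1 ≤ 1 / B * ((Fintype.card (Fin m → Fin n → F) : ℝ) * θ) ^ J := by
    rw [one_div_mul_eq_div, le_div_iff₀ hB, one_mul]
    exact hJ.le
  set O : ℕ → Set (ℕ → Fin m → Fin n → F) := fun j => {z | ∃ N ≥ j, ∃ q, HasDegree N q ∧
    distToPoly (Matrix.vecMul (ofPolyVec q) (ofDigitsMatrix z)) < ψ q} with hO
  refine le_dimH_of_cover hk dist_ofDigitsMatrix_lt_iff hσ (Z := ⋂ j, O j)
    (fun p hp => one_le_tsum_of_cover hθ hθ1.le hκθ.le O ?_ p hp) ?_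
  · intro j b
    obtain ⟨N₀, hN₀⟩ := hcont (b + J)
    obtain ⟨N, hN, t, ht, Q, hQne, hQ, hQcard⟩ := hψ (max N₀ (max j b))
    have hNj : j ≤ N := (le_max_left _ _).trans ((le_max_right _ _).trans hN)
    have hNb : b ≤ N := (le_max_right _ _).trans ((le_max_right _ _).trans hN)
    refine ⟨t, nearSet N Q (t - N), ?_, hNb.trans ht, saturated_nearSet N Q (by omega), ?_⟩
    · rintro z ⟨q, hq, hnear⟩
      refine ⟨N, hNj, q, (hQ q hq).1, ?_⟩
      refine ((distToPoly_lt_iff_near (hQ q hq).1.1 z _).2 hnear).trans_le ?_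
      refine le_trans (le_of_eq ?_) (hQ q hq).2
      congr 1
      omega
    · intro x
      refine contentGE_boost hθ hθ1.le hκθ.le hJ' x b fun y _ => ?_
      exact hN₀ N ((le_max_left _ _).trans hN) t ht Q hQne (fun q hq => (hQ q hq).1) hQcard y
  · intro z hz
    change {q | distToPoly _ < ψ q}.Infinite
    intro hfin
    obtain ⟨M, hM⟩ := (hfin.image fun q => ‖ofPolyVec q‖).bddAbove
    obtain ⟨j, hj⟩ := pow_unbounded_of_one_lt M hk
    obtain ⟨N, hN, q, hq, hlt⟩ := Set.mem_iInter.1 hz j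
    have h1 := hM ⟨q, hlt, rfl⟩
    simp only [norm_ofPolyVec_of_hasDegree hq] at h1
    exact absurd (h1.trans_lt hj) (not_lt.2 (pow_le_pow_right₀ hk.le hN))

end LaurentAtInfty

open LaurentAtInfty in
theorem theorem2 {F : Type*} [Field F] [Finite F] (m n : ℕ) (hm : 1 ≤ m) (hn : 1 ≤ n)
    (ψ : (Fin m → F[X]) → ℝ)
    (hψ_values : ∀ q, ψ q = 0 ∨ ∃ r : ℤ, ψ q = (Nat.card F : ℝ) ^ r)
    (hψ_bounded : ∃ C : ℝ, ∀ q, ψ q ≤ C)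
    (hψ_pos : {q : Fin m → F[X] | 0 < ψ q}.Infinite) :
    ((dimH (LaurentAtInfty.approxSet m n ψ) : ℝ≥0∞) : EReal)
      = (((n : ℝ) * ((m : ℝ) - 1) : ℝ) : EReal)
        + min (LaurentAtInfty.convExponent m n ψ) (n : EReal) := by
  obtain ⟨c, hc⟩ := exists_bound_pow hψ_bounded
  have hm1 : (1 : ℝ) ≤ m := by exact_mod_cast hm
  have hnm : (0 : ℝ) ≤ (n : ℝ) * ((m : ℝ) - 1) := mul_nonneg (Nat.cast_nonneg _) (by linarith)
  have hconv0 : (0 : EReal) ≤ convExponent m n ψ :=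
    le_iInf fun η => le_iInf fun hη => by
      exact_mod_cast (pos_of_summable hψ_values hc hψ_pos hη).le
  obtain ⟨e, he⟩ : ∃ e : ℝ, min (convExponent m n ψ) (n : EReal) = (e : EReal) := by
    refine ⟨_, (EReal.coe_toReal ?_ ?_).symm⟩
    · exact ne_top_of_le_ne_top (EReal.natCast_ne_top n) (min_le_right _ _)
    · exact ne_bot_of_le_ne_bot EReal.zero_ne_bot (le_min hconv0 (by exact_mod_cast Nat.zero_le n))
  have he0 : 0 ≤ e := by
    have : (0 : EReal) ≤ (e : EReal) := by
      rw [← he]; exact le_min hconv0 (by exact_mod_cast Nat.zero_le n)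
    exact_mod_cast this
  have hen : e ≤ n := by
    have : (e : EReal) ≤ ((n : ℝ) : EReal) := by rw [← he]; exact min_le_right _ _
    exact_mod_cast this
  have heconv : (e : EReal) ≤ convExponent m n ψ := by rw [← he]; exact min_le_left _ _
  have hdim : dimH (approxSet m n ψ) = ENNReal.ofReal (n * (m - 1) + e) := by
    refine le_antisymm ?_ ?_
    · rcases hen.lt_or_eq with hlt | heq
      · have hconv : convExponent m n ψ = (e : EReal) := by
          rcases min_choice (convExponent m n ψ) (n : EReal) with h | h
          · rw [← he, h]
          · rw [h] at he
            have : ((n : ℝ) : EReal) = (e : EReal) := he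
            exact absurd (by exact_mod_cast this) hlt.ne'
        refine ENNReal.le_of_forall_pos_le_add fun δ hδ _ => ?_
        have hδ' : (0 : ℝ) < δ := hδ
        have h1 : convExponent m n ψ < ((e + δ : ℝ) : EReal) := by
          rw [hconv]; exact_mod_cast lt_add_of_pos_right e hδ'
        simp only [convExponent, iInf_lt_iff] at h1
        obtain ⟨η, hη, hlt'⟩ := h1
        have hlt'' : η < e + δ := by exact_mod_cast hlt'
        refine (dimH_approxSet_le_of_summable hm hψ_values hc
          (pos_of_summable hψ_values hc hψ_pos hη).le hη).trans ?_
        rw [← ENNReal.ofReal_coe_nnreal, ← ENNReal.ofReal_add (by positivity) hδ'.le]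
        exact ENNReal.ofReal_le_ofReal (by linarith)
      · refine (dimH_approxSet_le_mul ψ).trans (le_of_eq ?_)
        rw [heq]
        congr 1
        ring
    · refine ENNReal.le_of_forall_pos_le_add fun δ hδ _ => ?_
      have hδ' : (0 : ℝ) < δ := hδ
      set σ : ℝ := n * (m - 1) + e - δ with hσdef
      rcases le_or_gt σ 0 with hσ | hσ
      · refine le_trans ?_ le_add_self
        rw [← ENNReal.ofReal_coe_nnreal]
        exact ENNReal.ofReal_le_ofReal (by linarith)
      · -- `s` is slightly less than `e`, but equal to `e` if `e = 0`, to keep `0 ≤ s`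
        set s : ℝ := e - min ((δ : ℝ) / 2) e with hs
        have hmin : min ((δ : ℝ) / 2) e ≤ δ / 2 := min_le_left _ _
        have hs0 : 0 ≤ s := sub_nonneg.2 (min_le_right _ _)
        have hse : s ≤ e := sub_le_self _ (le_min (by positivity) he0)
        have hmany : HasManyVectors n ψ s := by
          rcases he0.eq_or_lt with h0 | h0
          · have : s = 0 := le_antisymm (h0 ▸ hse) hs0
            rw [this]
            exact hasManyVectors_zero hψ_values hψ_pos
          · have hslt : s < e := sub_lt_self _ (lt_min (by positivity) h0)
            refine hasManyVectors_of_not_summable hψ_values hs0 (hse.trans hen)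
              (s' := (s + e) / 2) (by linarith) fun hsum => ?_
            have h1 : convExponent m n ψ ≤ (((s + e) / 2 : ℝ) : EReal) :=
              iInf_le_of_le _ (iInf_le _ hsum)
            have h2 : e ≤ (s + e) / 2 := by exact_mod_cast heconv.trans h1
            linarith
        have h1 := le_dimH_approxSet hm hn (σ := σ) (s := s) (ε := (s - e + δ) / 2)
          (by linarith) hs0 (hse.trans hen) hσ (by rw [hσdef]; ring) hmany
        calc ENNReal.ofReal (n * (m - 1) + e) = ENNReal.ofReal (σ + δ) := by
              rw [hσdef]; congr 1; ring
          _ = ENNReal.ofReal σ + δ := by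
              rw [ENNReal.ofReal_add hσ.le hδ'.le, ENNReal.ofReal_coe_nnreal]
          _ ≤ _ := by gcongr
  rw [hdim, he, EReal.coe_ennreal_ofReal, max_eq_left (by linarith), EReal.coe_add]
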